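/- Let $k\geq 2$ and let $2\leq d_1\leq\dots\leq d_k$ be integers; put $M=d_1+\dots+d_k-k$ and assume $M\geq 2k+3$. List the pairs $(m,j)$ with $1\leq m\leq k$, $1\leq j\leq d_m$ in the standard order: $(m,j)$ precedes $(m',j')$ if $j<j'$, or if $j=j'$ and $m<m'$. Remove all pairs with $j=1$ and then the last two pairs; $M-2$ pairs remain. Let $\delta(1),\dots,\delta(M-2)$ be their second entries, in this order. Let $\mathcal P=\prod_{i=1}^{M-2}\mathcal P_{\delta(i),M-1}$, where $\mathcal P_{a,M-1}$ is the vector space of homogeneous polynomials of degree $a$ in $M-1$ variables over $\mathbb C$ (zero included). For $1\leq i\leq M-2$ let $\mathcal B_i\subset\mathcal P$ be the set of tuples $(p_1,\dots,p_{M-2})$ such that the closed set $\{p_1=\dots=p_{i-1}=0\}\subset\mathbb P^{M-2}$ (which is $\mathbb P^{M-2}$ itself if $i=1$) has codimension $i-1$ in $\mathbb P^{M-2}$ and has an irreducible component $B$ with $p_i|_B\equiv 0$, where moreover, if $i=M-2$, the component $B$ is a curve of degree at least $2$. Proposition 3.2. For every $i\in\{1,\dots,M-2\}$, $$\operatorname{codim}(\mathcal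 B_i\subset\mathcal P)\geq 2M.$$ (The codimension of $\mathcal B_i$ is that of its Zariski closure, i.e. the least codimension of an irreducible component of the closure; it is $\infty$ for the empty set.) -/

import Mathlib

open scoped LinearAlgebra.Projectivization

noncomputable section

namespace FanoCI

/-! ### Degrees of the polynomials `p_1, …, p_{M-2}` -/

/-- The index pairs `(m, j)` (`j` between `1` and `d m`) of the homogeneous components `q_{m,j}` of
degree `j` of the `m`-th equation, listed in the standard order: first by the degree `j`, then by
the number `m` of the equation. -/
def standardOrder {k : ℕ} (d : Fin k → ℕ) : List (Fin k × ℕ) :=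
  (List.range' 1 (∑ m, d m)).flatMap fun j =>
    ((List.finRange k).filter fun m => j ≤ d m).map fun m => (m, j)

/-- The list `(δ(1), …, δ(M-2))` of the degrees that remain when all linear forms and the last two
polynomials are removed from the sequence `q_{m,j}` in the standard order. -/
def pDegrees {k : ℕ} (d : Fin k → ℕ) : List ℕ :=
  ((((standardOrder d).filter fun a => 2 ≤ a.2).dropLast).dropLast).map Prod.snd

/-- There are exactly `M - 2` remaining polynomials, where `M = d_1 + ⋯ + d_k - k`. -/
theorem length_pDegrees {k M : ℕ} (d : Fin k → ℕ) (hd : ∀ m, 2 ≤ d m)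
    (hM : ∑ m, d m = M + k) : (pDegrees d).length = M - 2 := by
  have hlen : ∀ l : List (Fin k), ∀ j : ℕ,
      (((l.filter fun m => j ≤ d m).map fun m => (m, j)).filter fun a => 2 ≤ a.2).length
        = (l.map fun m => if 2 ≤ j ∧ j ≤ d m then 1 else 0).sum := by
    intro l j
    induction l with
    | nil => simp
    | cons a t ih =>
      rw [List.map_cons, List.sum_cons, ← ih, List.filter_cons]
      by_cases h1 : j ≤ d a <;> by_cases h2 : 2 ≤ j <;>
        simp [h1, h2, Nat.add_comm]
  have hcount : ((standardOrder d).filter fun a => 2 ≤ a.2).length = M := by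
    rw [standardOrder, List.filter_flatMap, List.length_flatMap]
    simp only [hlen]
    have h1 : ∀ j : ℕ, ((List.finRange k).map fun m => if 2 ≤ j ∧ j ≤ d m then 1 else 0).sum
        = ∑ m, if 2 ≤ j ∧ j ≤ d m then 1 else 0 := by
      intro j
      rw [← List.ofFn_eq_map, List.sum_ofFn]
    simp only [h1]
    have h2 : ∀ (f : ℕ → ℕ) (n : ℕ), ((List.range' 1 n).map f).sum = ∑ j ∈ Finset.Icc 1 n, f j := by
      intro f n
      induction n with
      | zero => simp
      | succ n ih =>
        rw [List.range'_concat, List.map_append, List.sum_append, ih,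
          Finset.sum_Icc_succ_top (by omega)]
        simp [Nat.add_comm]
    rw [h2, Finset.sum_comm]
    have h3 : ∀ m, (∑ j ∈ Finset.Icc 1 (∑ m, d m), if 2 ≤ j ∧ j ≤ d m then 1 else 0) = d m - 1 := by
      intro m
      have hle : d m ≤ ∑ m, d m := Finset.single_le_sum (fun _ _ => Nat.zero_le _) (Finset.mem_univ m)
      rw [← Finset.card_filter]
      have : (Finset.Icc 1 (∑ m, d m)).filter (fun j => 2 ≤ j ∧ j ≤ d m) = Finset.Icc 2 (d m) := by
        ext j
        simp only [Finset.mem_filter, Finset.mem_Icc]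
        omega
      rw [this]
      simp
    simp only [h3]
    have h4 : ∑ m, d m = ∑ m, (d m - 1) + k := by
      have : ∑ m, d m = ∑ m, ((d m - 1) + 1) :=
        Finset.sum_congr rfl fun m _ => by have := hd m; omega
      rw [this, Finset.sum_add_distrib]
      simp
    omega
  simp only [pDegrees, List.length_map, List.length_dropLast, hcount]
  omega

/-- `delta d i` is the `i`-th remaining degree, counted from `0`. -/
def delta {k : ℕ} (d : Fin k → ℕ) (i : ℕ) : ℕ := (pDegrees d).getD i 0

/-! ### Closed subsets of complex projective space

`ℙ ℂ (Fin n → ℂ)` is the projective space of dimension `n - 1` with homogeneous coordinates indexed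
by `Fin n`. -/

/-- The polynomial `F` vanishes at the point `x` (meaningful for homogeneous `F`, for which it does
not depend on the vector representing `x`). -/
def VanishesAt {n : ℕ} (F : MvPolynomial (Fin n) ℂ) (x : ℙ ℂ (Fin n → ℂ)) : Prop :=
  MvPolynomial.eval x.rep F = 0

/-- For homogeneous polynomials, vanishing at a point can be tested on any representative. -/
theorem vanishesAt_mk_iff {n e : ℕ} {F : MvPolynomial (Fin n) ℂ} (hF : F.IsHomogeneous e)
    (v : Fin n → ℂ) (hv : v ≠ 0) :
    VanishesAt F (Projectivization.mk ℂ v hv) ↔ MvPolynomial.eval v F = 0 := by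
  obtain ⟨a, ha⟩ := Projectivization.exists_smul_eq_mk_rep ℂ v hv
  have h : MvPolynomial.eval ((a : ℂ) • v) F = (a : ℂ) ^ e * MvPolynomial.eval v F := by
    rw [MvPolynomial.eval_eq, MvPolynomial.eval_eq, Finset.mul_sum]
    refine Finset.sum_congr rfl fun m hm => ?_
    have hdeg : ∑ i ∈ m.support, m i = e := by
      have := hF (MvPolynomial.mem_support_iff.mp hm)
      rwa [Finsupp.weight_apply, Finsupp.sum, Finset.sum_congr rfl
        (fun i _ => by simp : ∀ i ∈ m.support, m i • (1 : Fin n → ℕ) i = m i)] at this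
    simp only [Pi.smul_apply, smul_eq_mul, mul_pow, Finset.prod_mul_distrib,
      Finset.prod_pow_eq_pow_sum, hdeg]
    ring
  rw [VanishesAt, ← ha]
  change MvPolynomial.eval ((a : ℂ) • v) F = 0 ↔ _
  rw [h]
  simp

/-- The Zariski topology on projective space: the sets `{F ≠ 0}` with `F` homogeneous form a basis
of open sets. -/
abbrev zariskiTopology (n : ℕ) : TopologicalSpace (ℙ ℂ (Fin n → ℂ)) :=
  TopologicalSpace.generateFrom
    {U | ∃ (F : MvPolynomial (Fin n) ℂ) (e : ℕ), F.IsHomogeneous e ∧ U = {x | ¬ VanishesAt F x}}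

/-- `B` is an irreducible component of `Z`: a maximal subset of `Z` that is irreducible in the
Zariski topology. -/
def IsComponent {n : ℕ} (B Z : Set (ℙ ℂ (Fin n → ℂ))) : Prop :=
  Maximal (fun s => @IsIrreducible _ (zariskiTopology n) s ∧ s ⊆ Z) B

/-- The homogeneous ideal of `X`, generated by the homogeneous polynomials vanishing on `X`. -/
def homogIdeal {n : ℕ} (X : Set (ℙ ℂ (Fin n → ℂ))) : Ideal (MvPolynomial (Fin n) ℂ) :=
  Ideal.span {F | (∃ e, F.IsHomogeneous e) ∧ ∀ x ∈ X, VanishesAt F x}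

/-- The codimension of (the Zariski closure of) `X` in projective space: the height of its
homogeneous ideal, i.e. the least codimension of a component. It is `⊤` for the empty set. -/
def projCodim {n : ℕ} (X : Set (ℙ ℂ (Fin n → ℂ))) : ℕ∞ := (homogIdeal X).height

/-- The linear subspace of projective space defined by a vector subspace `W`. -/
def linearSubspace {n : ℕ} (W : Submodule ℂ (Fin n → ℂ)) : Set (ℙ ℂ (Fin n → ℂ)) :=
  {x | x.submodule ≤ W}

/-- The degree of a closed irreducible subset `X`: the largest number of points in which `X` meets a
linear subspace of complementary dimension (`dim ℙ(W) = codim X`, so `dim W = codim X + 1`) that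
meets it in finitely many points. -/
def projDegree {n : ℕ} (X : Set (ℙ ℂ (Fin n → ℂ))) : ℕ∞ :=
  ⨆ (W : Submodule ℂ (Fin n → ℂ)) (_ : (Module.finrank ℂ W : ℕ∞) = projCodim X + 1)
    (_ : (X ∩ linearSubspace W).Finite), (X ∩ linearSubspace W).encard

/-- `X` has dimension one: its codimension in the `(n - 1)`-dimensional projective space is
`n - 2`. -/
def IsCurve {n : ℕ} (X : Set (ℙ ℂ (Fin n → ℂ))) : Prop := projCodim X + 2 = (n : ℕ∞)

/-! ### The parameter space and the bad sets -/

/-- The space of tuples of homogeneous polynomials of degrees `δ 0, …, δ (r - 1)` in `n` variables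
(in each degree, the zero polynomial is included). -/
abbrev ParamSpace (n : ℕ) {r : ℕ} (δ : Fin r → ℕ) : Type :=
  (i : Fin r) → MvPolynomial.homogeneousSubmodule (Fin n) ℂ (δ i)

/-- The affine coordinates on the parameter space: all coefficients of all the polynomials. -/
abbrev CoeffIndex (n : ℕ) {r : ℕ} (δ : Fin r → ℕ) : Type :=
  (i : Fin r) × {m : Fin n →₀ ℕ // m.degree = δ i}

/-- The coordinates (coefficients) of a tuple of polynomials. -/
def coords {n r : ℕ} {δ : Fin r → ℕ} (p : ParamSpace n δ) : CoeffIndex n δ → ℂ :=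
  fun a => MvPolynomial.coeff a.2.1 (p a.1 : MvPolynomial (Fin n) ℂ)

/-- The coefficients identify the parameter space with the affine space. -/
theorem coords_bijective {n r : ℕ} (δ : Fin r → ℕ) :
    Function.Bijective (coords : ParamSpace n δ → (CoeffIndex n δ → ℂ)) := by
  classical
  constructor
  · intro p q h
    funext i
    ext m
    by_cases hm : m.degree = δ i
    · exact congrFun h ⟨i, m, hm⟩
    · have hp := (MvPolynomial.mem_homogeneousSubmodule _ _).mp (p i).2
      have hq := (MvPolynomial.mem_homogeneousSubmodule _ _).mp (q i).2
      rw [hp.coeff_eq_zero hm, hq.coeff_eq_zero hm]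
  · intro c
    have hfin : ∀ i, Finite {m : Fin n →₀ ℕ // m.degree = δ i} := fun i =>
      (Finsupp.finite_of_degree_le (σ := Fin n) (δ i)).subset (fun m hm => le_of_eq hm)
    have := fun i => Fintype.ofFinite {m : Fin n →₀ ℕ // m.degree = δ i}
    refine ⟨fun i => ⟨∑ m : {m : Fin n →₀ ℕ // m.degree = δ i},
      MvPolynomial.monomial m.1 (c ⟨i, m⟩), ?_⟩, ?_⟩
    · exact Submodule.sum_mem _ fun m _ => MvPolynomial.isHomogeneous_monomial _ m.2
    · funext a
      obtain ⟨i, m⟩ := a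
      simp only [coords, MvPolynomial.coeff_sum, MvPolynomial.coeff_monomial]
      rw [Finset.sum_eq_single m]
      · simp
      · intro b _ hb
        rw [if_neg fun h => hb (Subtype.ext h)]
      · simp

/-- The codimension of (the Zariski closure of) a set of tuples in the affine space of all tuples:
the height of the ideal of the polynomials in the coefficients that vanish on it, i.e. the least
codimension of a component of the closure. It is `⊤` for the empty set. -/
def paramCodim {n r : ℕ} {δ : Fin r → ℕ} (S : Set (ParamSpace n δ)) : ℕ∞ :=
  (MvPolynomial.vanishingIdeal ℂ (coords '' S)).height

/-- The closed set `{p_j = 0 for all j < i}`, where the polynomials are numbered from `0`. -/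
def zerosBefore {n r : ℕ} {δ : Fin r → ℕ} (p : ParamSpace n δ) (i : Fin r) :
    Set (ℙ ℂ (Fin n → ℂ)) :=
  {x | ∀ j < i, VanishesAt (p j : MvPolynomial (Fin n) ℂ) x}

/-- The set of tuples that are bad at step `i`. As indices are counted from `0`, there are `i`
polynomials before `p i`, and the last step is `i + 1 = r`. -/
def badSet {n r : ℕ} (δ : Fin r → ℕ) (i : Fin r) : Set (ParamSpace n δ) :=
  {p | projCodim (zerosBefore p i) = ((i : ℕ) : ℕ∞) ∧
    ∃ B, IsComponent B (zerosBefore p i) ∧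
      (∀ x ∈ B, VanishesAt (p i : MvPolynomial (Fin n) ℂ) x) ∧
      ((i : ℕ) + 1 = r → IsCurve B ∧ 2 ≤ projDegree B)}

end FanoCI

end

noncomputable section

namespace FanoCI

/-! ### Coordinates that stay independent modulo a prime ideal -/

section

/-! Put `r = M - 2` and `n = M - 1`, so that `2M = 2r + 4`, and count indices from 0. The bound is a
parameter count with general points. If `p` is bad at step `i`, then `p 0, …, p i` vanish on an
irreducible cone `C`, the cone over `B`, of dimension at least `m = n - i`. Let `E` be the dimension
of the linear span of `C`. Take `E + q + x` general points of `C`: the first `E` span, each of the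
next `q` is given by `E` coefficients with respect to them, and `x` further points are added.

Suppose that the first `E + q` points impose independent conditions in degree `δ j` for all `j < i`,
and that all the points do so in degree `δ i`. Besides the parameters of the tuple, the values of
`m` linear forms at each point are free. On the other hand, everything is algebraic over the
following data: `E n + E q` parameters for the first `E + q` points; the coefficients of each `p j`,
`j < i`, that `E + q` linear conditions leave free; `m` parameters for each of the `x` further
points, which are algebraic over the `p j` and these values; the coefficients of `p i` left free by
`E + q + x` conditions; and all coefficients of the later polynomials. Comparing the two counts
gives codimension at least `q (n - E) + E + q + x`. This is `add_card_le_height`.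

It remains to choose `q` and `x` (`exists_numbers_of_points`). Two lower bounds for the number of
independent forms on `C` are available: monomials in `m` algebraically independent linear forms
(`hasIndependentForms_monomials`), and `a (E - 1) + 1` forms of degree `a`
(`HasIndependentForms.pow_degree`). At most `k` pairs share a degree, so `δ ≥ 3` from index `k` on
and `δ ≥ 4` from index `2k` on (`add_two_le_delta`). The second bound is used with `E ≥ 3`, which
follows from `E ≥ m` except at the last step; there the condition that `B` has degree at least 2
excludes a line (`three_le_finrank_span`).

No incidence variety is constructed. `exists_generic_point` maps the ring of all functions on a set
of pairs (tuple, points) to a field, where the count becomes one of transcendence degrees. The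
finiteness of the points with given values of the linear forms comes from `exists_multipliers`, on a
dense part of each component. -/

theorem height_le_height_map_C {R : Type*} [CommRing R] [IsNoetherianRing R] (p : Ideal R)
    [p.IsPrime] :
    p.height ≤ (p.map (Polynomial.C : R →+* Polynomial R)).height := by
  have : (p.map (Polynomial.C : R →+* Polynomial R)).IsPrime := Ideal.isPrime_map_C_of_isPrime
  have : (p.map (Polynomial.C : R →+* Polynomial R)).LiesOver p := ⟨by
    ext x
    simp only [Ideal.under, Ideal.mem_comap, Ideal.mem_map_C_iff, Polynomial.algebraMap_eq,
      Polynomial.coeff_C]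
    constructor
    · intro h n
      split_ifs <;> simp [h]
    · intro h; simpa using h 0⟩
  rw [Ideal.height_eq_height_add_of_liesOver_of_hasGoingDown p
    (P := p.map (Polynomial.C : R →+* Polynomial R))]
  exact le_self_add

/-- A prime ideal of height `h` in a polynomial ring in `N` variables admits `N - h` variables that
are algebraically independent modulo it. -/
theorem exists_independent_variables {k : Type*} [Field k] (σ : Type) [Finite σ] :
    ∀ (P : Ideal (MvPolynomial σ k)) [P.IsPrime], ∃ (κ : Type) (_ : Finite κ) (u : κ → σ),
      (∀ f : MvPolynomial κ k, MvPolynomial.rename u f ∈ P → f = 0) ∧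
      (Nat.card σ : ℕ∞) ≤ P.height + Nat.card κ := by
  classical
  induction σ using Finite.induction_empty_option with
  | @of_equiv α β e ih =>
    intro P hP
    let E := MvPolynomial.renameEquiv k e
    obtain ⟨κ, hκ, u, hu, hc⟩ := ih (P.comap E.toRingEquiv)
    refine ⟨κ, hκ, e ∘ u, ?_, ?_⟩
    · intro f hf
      apply hu
      rw [Ideal.mem_comap]
      have : E.toRingEquiv (MvPolynomial.rename u f) = MvPolynomial.rename (e ∘ u) f :=
        MvPolynomial.rename_rename u e f
      rwa [this]
    · have h3 := RingEquiv.height_comap E.toRingEquiv P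
      rw [← Nat.card_congr e, ← h3]
      exact hc
  | h_empty =>
    intro P hP
    refine ⟨PEmpty, inferInstance, PEmpty.elim, ?_, by simp⟩
    intro f hf
    by_contra hne
    apply hP.ne_top
    rw [MvPolynomial.eq_C_of_isEmpty f] at hf hne
    rw [MvPolynomial.rename_C] at hf
    refine Ideal.eq_top_of_isUnit_mem _ hf (IsUnit.map _ (Ne.isUnit ?_))
    intro h0
    rw [h0] at hne
    simp at hne
  | @h_option α _ ih =>
    intro P hP
    let E := (MvPolynomial.optionEquivLeft k α).toRingEquiv
    let P' : Ideal (Polynomial (MvPolynomial α k)) := P.comap E.symm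
    have hP' : P'.IsPrime := inferInstance
    have hh : P'.height = P.height := RingEquiv.height_comap E.symm P
    let p : Ideal (MvPolynomial α k) := P'.comap Polynomial.C
    obtain ⟨κ, hκ, u, hu, hc⟩ := ih p
    have hle : p.map Polynomial.C ≤ P' := Ideal.map_comap_le
    have hpr : (p.map (Polynomial.C : MvPolynomial α k →+* _)).IsPrime :=
      Ideal.isPrime_map_C_of_isPrime
    -- If the contraction `p` extends to a prime strictly below `P'`, the height grows by one and
    -- the variables found for `p` suffice. If it extends to `P'` itself, the height need not grow,
    -- but the new variable is free modulo `P'` and joins the family.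
    rcases hle.lt_or_eq with hlt | heq
    · refine ⟨κ, hκ, some ∘ u, ?_, ?_⟩
      · intro f hf
        apply hu
        change E.symm (Polynomial.C (MvPolynomial.rename u f)) ∈ P
        have : E (MvPolynomial.rename (some ∘ u) f) = Polynomial.C (MvPolynomial.rename u f) := by
          change ((MvPolynomial.optionEquivLeft k α : _ →ₐ[k] _).comp
            (MvPolynomial.rename (some ∘ u))) f =
            ((IsScalarTower.toAlgHom k (MvPolynomial α k) (Polynomial (MvPolynomial α k))).comp
              (MvPolynomial.rename u)) f
          congr 1
          ext x : 1
          simp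
        rw [← this, RingEquiv.symm_apply_apply]
        exact hf
      · have h1 := height_le_height_map_C p
        have h2 := Ideal.height_add_one_le_of_lt_of_isPrime hlt
        rw [← hh]
        calc _ = (Nat.card α : ℕ∞) + 1 := by simp
          _ ≤ p.height + Nat.card κ + 1 := by gcongr
          _ ≤ (p.map Polynomial.C).height + Nat.card κ + 1 := by gcongr
          _ = (p.map Polynomial.C).height + 1 + Nat.card κ := by ring
          _ ≤ _ := by gcongr
    · refine ⟨Option κ, inferInstance, Option.map u, ?_, ?_⟩
      · intro f hf
        have h1 : E (MvPolynomial.rename (Option.map u) f) =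
            Polynomial.map (MvPolynomial.rename u).toRingHom (MvPolynomial.optionEquivLeft k κ f) := by
          change ((MvPolynomial.optionEquivLeft k α : _ →ₐ[k] _).comp
            (MvPolynomial.rename (Option.map u))) f =
            ((Polynomial.mapAlgHom (MvPolynomial.rename u)).comp
              (MvPolynomial.optionEquivLeft k κ : _ →ₐ[k] _)) f
          congr 1
          ext x : 1
          rcases x with _ | x <;> simp
        have h2 : E (MvPolynomial.rename (Option.map u) f) ∈ p.map Polynomial.C := by
          rw [heq]
          change E.symm (E _) ∈ P
          rw [RingEquiv.symm_apply_apply]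
          exact hf
        rw [h1, Ideal.mem_map_C_iff] at h2
        apply (MvPolynomial.optionEquivLeft k κ).injective
        rw [map_zero]
        ext1 j
        have := h2 j
        rw [Polynomial.coeff_map] at this
        rw [hu _ this, Polynomial.coeff_zero]
      · have : Nat.card (Option κ) = Nat.card κ + 1 := Finite.card_option
        rw [← hh, ← heq, this]
        calc _ = (Nat.card α : ℕ∞) + 1 := by simp
          _ ≤ p.height + Nat.card κ + 1 := by gcongr
          _ ≤ (p.map Polynomial.C).height + Nat.card κ + 1 := by
            gcongr; exact height_le_height_map_C p
          _ = _ := by push_cast; ring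

end

/-! ### Generic points and counting in extension fields -/

section

/-- If no nonzero polynomial vanishes identically along a family of functions on `W`, then the
function ring of `W` has a homomorphism to a field under which the family becomes algebraically
independent. -/
theorem exists_generic_point {W κ : Type} (u : κ → W → ℂ)
    (h : ∀ f : MvPolynomial κ ℂ, f ≠ 0 → ∃ w, MvPolynomial.eval (fun k => u k w) f ≠ 0) :
    ∃ (Ω : Type) (_ : Field Ω) (_ : Algebra ℂ Ω) (φ : (W → ℂ) →ₐ[ℂ] Ω),
      AlgebraicIndependent ℂ fun k => φ (u k) := by
  -- The nonzero polynomials in the `u k` form a multiplicative set of functions that avoids 0. A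
  -- prime `Q` disjoint from it keeps them nonzero in the fraction field of the quotient, while
  -- every identity valid pointwise on `W` is preserved.
  let M : Submonoid (W → ℂ) :=
    (nonZeroDivisors (MvPolynomial κ ℂ)).map (MvPolynomial.aeval (R := ℂ) u)
  have hev : ∀ (f : MvPolynomial κ ℂ) (w : W),
      MvPolynomial.aeval (R := ℂ) u f w = MvPolynomial.eval (fun k => u k w) f := by
    intro f w
    have : ((Pi.evalAlgHom ℂ (fun _ : W => ℂ) w).comp (MvPolynomial.aeval (R := ℂ) u)) =
        MvPolynomial.aeval (fun k => u k w) := by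
      ext; simp
    have := congrArg (fun F => F f) this
    simpa [MvPolynomial.aeval_eq_eval] using this
  have hdisj : Disjoint ((⊥ : Ideal (W → ℂ)) : Set (W → ℂ)) (M : Set (W → ℂ)) := by
    rw [Set.disjoint_left]
    rintro x hx ⟨f, hf, hfx⟩
    have hx0 : x = 0 := by simpa using hx
    obtain ⟨w, hw⟩ := h f (nonZeroDivisors.ne_zero hf)
    apply hw
    rw [← hev]
    change (MvPolynomial.aeval (R := ℂ) u) f = x at hfx
    rw [hfx, hx0]; rfl
  obtain ⟨Q, hQ, -, hQM⟩ := Ideal.exists_le_prime_disjoint ⊥ M hdisj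
  let A := (W → ℂ) ⧸ Q
  refine ⟨FractionRing A, inferInstance, inferInstance,
    (IsScalarTower.toAlgHom ℂ A (FractionRing A)).comp (Ideal.Quotient.mkₐ ℂ Q), ?_⟩
  rw [algebraicIndependent_iff]
  intro f hf
  by_contra hne
  have h1 : (IsScalarTower.toAlgHom ℂ A (FractionRing A)).comp (Ideal.Quotient.mkₐ ℂ Q)
      (MvPolynomial.aeval (R := ℂ) u f) = 0 := by
    rw [← hf]
    exact congrArg (fun F => F f)
      (MvPolynomial.comp_aeval u ((IsScalarTower.toAlgHom ℂ A (FractionRing A)).comp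
        (Ideal.Quotient.mkₐ ℂ Q)))
  have h2 : (Ideal.Quotient.mkₐ ℂ Q) (MvPolynomial.aeval (R := ℂ) u f) = 0 :=
    (map_eq_zero_iff _ (IsFractionRing.injective A (FractionRing A))).mp h1
  rw [Ideal.Quotient.mkₐ_eq_mk, Ideal.Quotient.eq_zero_iff_mem] at h2
  exact Set.disjoint_left.mp hQM h2 ⟨f, mem_nonZeroDivisors_of_ne_zero hne, rfl⟩

/-! ### Algebraic closure inside an extension field -/

section Closure

variable {k Ω : Type} [Field k] [Field Ω] [Algebra k Ω]

/-- The elements algebraic over the field generated by `X`. -/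
def algClosureOf (k : Type) {Ω : Type} [Field k] [Field Ω] [Algebra k Ω] (X : Set Ω) :
    IntermediateField k Ω :=
  (algebraicClosure (IntermediateField.adjoin k X) Ω).restrictScalars k

theorem mem_algClosureOf {X : Set Ω} {a : Ω} :
    a ∈ algClosureOf k X ↔ IsAlgebraic (IntermediateField.adjoin k X) a := by
  rw [algClosureOf, IntermediateField.mem_restrictScalars, mem_algebraicClosure_iff]

theorem subset_algClosureOf (X : Set Ω) : X ⊆ algClosureOf k X := fun a ha => by
  rw [SetLike.mem_coe, mem_algClosureOf]
  exact isAlgebraic_algebraMap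
    (⟨a, IntermediateField.subset_adjoin k X ha⟩ : IntermediateField.adjoin k X)

theorem mem_algClosureOf_of_isAlgebraic {X : Set Ω} {a : Ω}
    (h : IsAlgebraic (algClosureOf k X) a) : a ∈ algClosureOf k X := by
  rw [algClosureOf, IntermediateField.mem_restrictScalars, mem_algebraicClosure_iff]
  have : Algebra.IsAlgebraic (IntermediateField.adjoin k X)
    (algebraicClosure (IntermediateField.adjoin k X) Ω) := inferInstance
  have h' : IsAlgebraic (algebraicClosure (IntermediateField.adjoin k X) Ω) a := h
  exact h'.restrictScalars (IntermediateField.adjoin k X)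

/-- Identifies this closure with the closure operator of the matroid of algebraic independence,
which makes rank arguments available. -/
theorem coe_algClosureOf (X : Set Ω) :
    (algClosureOf k X : Set Ω) = (AlgebraicIndependent.matroid k Ω).closure X := by
  rw [AlgebraicIndependent.matroid_closure_eq]
  ext a
  rw [SetLike.mem_coe, mem_algClosureOf, SetLike.mem_coe, Subalgebra.mem_algebraicClosure]
  exact IntermediateField.isAlgebraic_adjoin_iff

theorem algClosureOf_le {X Y : Set Ω} (h : X ⊆ algClosureOf k Y) :
    algClosureOf k X ≤ algClosureOf k Y := by
  rw [← SetLike.coe_subset_coe, coe_algClosureOf, coe_algClosureOf]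
  rw [coe_algClosureOf] at h
  exact (AlgebraicIndependent.matroid k Ω).closure_subset_closure_of_subset_closure h

theorem algClosureOf_mono {X Y : Set Ω} (h : X ⊆ Y) : algClosureOf k X ≤ algClosureOf k Y :=
  algClosureOf_le (h.trans (subset_algClosureOf Y))

/-- Algebraically independent elements of the algebraic closure of the field generated by `X` are
at most as many as the elements of `X`. -/
theorem card_le_of_algebraicIndependent {κ : Type} [Finite κ] {v : κ → Ω}
    (hv : AlgebraicIndependent k v) {X : Set Ω} (hvX : ∀ i, v i ∈ algClosureOf k X) :
    (Nat.card κ : ℕ∞) ≤ X.encard := by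
  have h1 : (AlgebraicIndependent.matroid k Ω).Indep (Set.range v) := by
    rw [AlgebraicIndependent.matroid_indep_iff]
    exact hv.coe_range
  have h2 : Set.range v ⊆ (AlgebraicIndependent.matroid k Ω).closure X := by
    rw [← coe_algClosureOf]
    rintro _ ⟨i, rfl⟩
    exact hvX i
  have h3 := h1.eRk_eq_encard
  have h4 := (AlgebraicIndependent.matroid k Ω).eRk_mono h2
  rw [Matroid.eRk_closure_eq, h3] at h4
  have h5 := h4.trans ((AlgebraicIndependent.matroid k Ω).eRk_le_encard X)
  have h6 : (Set.range v).encard = Nat.card κ := by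
    rw [← Set.image_univ, hv.injective.encard_image, Set.encard_univ, ENat.card_eq_coe_natCard]
  rwa [h6] at h5

/-- A family of the size of the number of algebraically independent elements that it generates is
algebraically independent. -/
theorem algebraicIndependent_of_card_le {κ τ : Type} [Finite κ] [Finite τ] {v : κ → Ω}
    (hv : AlgebraicIndependent k v) {w : τ → Ω} (hvw : ∀ i, v i ∈ algClosureOf k (Set.range w))
    (hcard : Nat.card τ ≤ Nat.card κ) : AlgebraicIndependent k w := by
  classical
  have h1 := card_le_of_algebraicIndependent hv hvw
  obtain ⟨I, hI⟩ := (AlgebraicIndependent.matroid k Ω).exists_isBasis (Set.range w)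
  have h2 : (Nat.card κ : ℕ∞) ≤ I.encard := by
    refine card_le_of_algebraicIndependent hv fun i => ?_
    have := hvw i
    rw [← SetLike.mem_coe, coe_algClosureOf] at this ⊢
    rwa [hI.closure_eq_closure]
  have hfin : (Set.range w).Finite := Set.finite_range w
  have h3 : (Set.range w).encard ≤ Nat.card τ := by
    rw [← Set.image_univ]
    refine (Set.encard_image_le _ _).trans ?_
    rw [Set.encard_univ, ENat.card_eq_coe_natCard]
  -- A transcendence basis `I` inside the range of `w` has at least `Nat.card κ ≥ Nat.card τ`
  -- elements, so it exhausts the range; the same count makes `w` injective.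
  have hIw : I = Set.range w := by
    refine (hfin.subset hI.subset).eq_of_subset_of_encard_le hI.subset (h3.trans (le_trans ?_ h2))
    exact_mod_cast hcard
  have hinj : Function.Injective w := by
    have h4 : (Set.range w).ncard = Nat.card τ := by
      apply le_antisymm
      · have := h3
        rw [← hfin.cast_ncard_eq] at this
        exact_mod_cast this
      · rw [← hIw]
        have hIf : I.Finite := hfin.subset hI.subset
        have := h2
        rw [← hIf.cast_ncard_eq] at this
        have : Nat.card κ ≤ I.ncard := by exact_mod_cast this
        omega
    rw [← Set.image_univ] at h4
    have := (Set.ncard_image_iff (s := (Set.univ : Set τ)) (f := w) Set.finite_univ).mp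
      (by rw [h4, Set.ncard_univ])
    exact Set.injOn_univ.mp this
  have h5 := hI.indep
  rw [hIw, AlgebraicIndependent.matroid_indep_iff] at h5
  exact h5.comp (fun t => ⟨w t, t, rfl⟩) (fun a b hab => hinj (congrArg Subtype.val hab))

/-- Solutions of independent linear equations over a subfield `E`: all coordinates are
`E`-combinations of as many elements as the equations leave free. -/
theorem exists_free_coordinates (E : IntermediateField k Ω) {N ι : Type} [Fintype N] [Fintype ι]
    (v : ι → N → Ω) (hvE : ∀ l a, v l a ∈ E) (hv : LinearIndependent Ω v)
    (x : N → Ω) (hx : ∀ l, ∑ a, v l a * x a = 0) :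
    ∃ G : Set Ω, G.encard + Fintype.card ι ≤ Fintype.card N ∧
      ∀ F : IntermediateField k Ω, E ≤ F → G ⊆ F → ∀ a, x a ∈ F := by
  classical
  -- The image of `L` is the `E`-span of the coordinates of `x`. The equations lie in its kernel, so
  -- rank-nullity bounds the dimension of this span, and `G` is a basis of it.
  let L : (N → E) →ₗ[E] Ω := Fintype.linearCombination E x
  let v' : ι → N → E := fun l a => ⟨v l a, hvE l a⟩
  have hv' : LinearIndependent E v' := by
    have h1 : LinearIndependent E v := hv.restrict_scalars (by
      intro a b hab; simpa [Algebra.smul_def] using hab)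
    let T : (N → E) →ₗ[E] (N → Ω) :=
      { toFun := fun y a => (y a : Ω), map_add' := fun _ _ => by ext; simp
        map_smul' := fun _ _ => by ext; simp [Algebra.smul_def] }
    exact LinearIndependent.of_comp T (by exact h1)
  have hker : ∀ l, v' l ∈ LinearMap.ker L := by
    intro l
    rw [LinearMap.mem_ker, Fintype.linearCombination_apply, ← hx l]
    rfl
  have h2 : Fintype.card ι ≤ Module.finrank E (LinearMap.ker L) := by
    have : LinearIndependent E (fun l => (⟨v' l, hker l⟩ : LinearMap.ker L)) :=
      LinearIndependent.of_comp (LinearMap.ker L).subtype (by exact hv')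
    exact this.fintype_card_le_finrank
  have h3 := LinearMap.finrank_range_add_finrank_ker L
  rw [Module.finrank_fintype_fun_eq_card] at h3
  have : Module.Finite E (LinearMap.range L) := Module.Finite.range L
  have : Module.Free E (LinearMap.range L) := Module.Free.of_divisionRing E _
  let b := Module.finBasis E (LinearMap.range L)
  refine ⟨Set.range fun i => (b i : Ω), ?_, ?_⟩
  · have : (Set.range fun i => (b i : Ω)).encard ≤ Module.finrank E (LinearMap.range L) := by
      rw [← Set.image_univ]
      refine (Set.encard_image_le _ _).trans ?_
      simp
    calc _ ≤ (Module.finrank E (LinearMap.range L) : ℕ∞) + Module.finrank E (LinearMap.ker L) := by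
          gcongr
      _ = _ := by rw [← h3]; push_cast; rfl
  · intro F hEF hGF a
    have hxa : x a ∈ LinearMap.range L := ⟨Pi.single a 1, by
      rw [Fintype.linearCombination_apply_single, one_smul]⟩
    have h4 := b.sum_repr ⟨x a, hxa⟩
    have h5 := congrArg (Subtype.val) h4
    simp only [Submodule.coe_sum, Submodule.coe_smul, Algebra.smul_def] at h5
    rw [← h5]
    refine sum_mem fun i _ => mul_mem (hEF ?_) (hGF ⟨i, rfl⟩)
    exact (b.repr ⟨x a, hxa⟩ i).2

end Closure

end

/-! ### Monomial relations and algebraicity -/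

section

instance finite_monomials (n D : ℕ) : Finite {m : Fin n →₀ ℕ // m.degree = D} :=
  (Finsupp.finite_of_degree_le (σ := Fin n) D).subset fun _ hm => le_of_eq hm

instance fintypeMonomials (n D : ℕ) : Fintype {m : Fin n →₀ ℕ // m.degree = D} :=
  Fintype.ofFinite _

theorem finsupp_degree_eq_sum {n : ℕ} (m : Fin n →₀ ℕ) : m.degree = ∑ t, m t := by
  rw [Finsupp.degree_apply]
  exact Finset.sum_subset (Finset.subset_univ _) fun t _ ht => Finsupp.notMem_support_iff.mp ht

theorem aeval_eq_sum_monomials {n D : ℕ} {A : Type*} [CommRing A] [Algebra ℂ A]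
    {f : MvPolynomial (Fin n) ℂ} (hf : f.IsHomogeneous D) (y : Fin n → A) :
    MvPolynomial.aeval y f = ∑ m : {m : Fin n →₀ ℕ // m.degree = D},
      algebraMap ℂ A (f.coeff m.1) * ∏ t, y t ^ m.1 t := by
  classical
  rw [MvPolynomial.aeval_def, MvPolynomial.eval₂_eq']
  have h1 : ∀ m ∈ f.support, m.degree = D := by
    intro m hm
    by_contra h
    exact (MvPolynomial.mem_support_iff.mp hm) (hf.coeff_eq_zero h)
  rw [← Finset.sum_subtype_of_mem (p := fun m : Fin n →₀ ℕ => m.degree = D)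
    (fun m => algebraMap ℂ A (f.coeff m) * ∏ t, y t ^ m t) h1]
  refine Finset.sum_subset (Finset.subset_univ _) ?_
  intro m _ hm
  have : f.coeff m.1 = 0 := by
    by_contra h
    exact hm (by simpa [Finset.mem_subtype] using h)
  rw [this]; simp

theorem eval_eq_sum_monomials {n D : ℕ}
    {f : MvPolynomial (Fin n) ℂ} (hf : f.IsHomogeneous D) (y : Fin n → ℂ) :
    MvPolynomial.eval y f = ∑ m : {m : Fin n →₀ ℕ // m.degree = D},
      f.coeff m.1 * ∏ t, y t ^ m.1 t := by
  have := aeval_eq_sum_monomials hf y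
  rwa [MvPolynomial.aeval_eq_eval] at this

/-- If the monomials of degree `D` in the `y t` are combinations, through an invertible matrix, of
monomials of smaller degree, then the `y t` are algebraic. -/
theorem isAlgebraic_of_monomial_relations {F Ω : Type} [Field F] [Field Ω] [Algebra F Ω] {n D : ℕ}
    (y : Fin n → Ω)
    (ε : Matrix {m : Fin n →₀ ℕ // m.degree = D} {m : Fin n →₀ ℕ // m.degree = D} F)
    (hdet : ε.det ≠ 0)
    (hrel : ∀ μ, ∑ ν, algebraMap F Ω (ε μ ν) * ∏ t, y t ^ ν.1 t ∈
      Submodule.span F {x | ∃ κ : Fin n →₀ ℕ, κ.degree < D ∧ x = ∏ t, y t ^ κ t}) (t : Fin n) :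
    IsAlgebraic F (y t) := by
  classical
  set U := Submodule.span F {x | ∃ κ : Fin n →₀ ℕ, κ.degree < D ∧ x = ∏ t, y t ^ κ t} with hU
  have hfg : U.FG := by
    have hfin : {x | ∃ κ : Fin n →₀ ℕ, κ.degree < D ∧ x = ∏ t, y t ^ κ t}.Finite := by
      refine ((Finsupp.finite_of_degree_le (σ := Fin n) D).image
        (fun κ : Fin n →₀ ℕ => ∏ t, y t ^ κ t)).subset ?_
      rintro x ⟨κ, hκ, rfl⟩
      exact ⟨κ, le_of_lt hκ, rfl⟩
    exact Submodule.fg_span hfin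
  have htop : ∀ ν : {m : Fin n →₀ ℕ // m.degree = D}, ∏ t, y t ^ ν.1 t ∈ U := by
    intro ν
    have h1 : ε⁻¹ * ε = 1 := Matrix.nonsing_inv_mul _ (Ne.isUnit hdet)
    have h2 : ∏ t, y t ^ ν.1 t = ∑ μ, ε⁻¹ ν μ • ∑ κ, algebraMap F Ω (ε μ κ) * ∏ t, y t ^ κ.1 t := by
      simp only [Finset.smul_sum]
      rw [Finset.sum_comm]
      have h3 : ∀ κ : {m : Fin n →₀ ℕ // m.degree = D},
          ∑ μ, ε⁻¹ ν μ • (algebraMap F Ω (ε μ κ) * ∏ t, y t ^ κ.1 t) =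
            algebraMap F Ω ((ε⁻¹ * ε) ν κ) * ∏ t, y t ^ κ.1 t := by
        intro κ
        rw [Matrix.mul_apply, map_sum, Finset.sum_mul]
        refine Finset.sum_congr rfl fun μ _ => ?_
        rw [Algebra.smul_def, map_mul, mul_assoc]
      rw [Finset.sum_congr rfl fun κ _ => h3 κ, h1, Finset.sum_eq_single ν]
      · simp
      · intro κ _ hκ
        rw [Matrix.one_apply_ne hκ.symm, map_zero, zero_mul]
      · simp
    rw [h2]
    exact U.sum_mem fun μ _ => U.smul_mem _ (hrel μ)
  have hle : ∀ κ : Fin n →₀ ℕ, κ.degree ≤ D → ∏ t, y t ^ κ t ∈ U := by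
    intro κ hκ
    rcases hκ.lt_or_eq with h | h
    · exact Submodule.subset_span ⟨κ, h, rfl⟩
    · exact htop ⟨κ, h⟩
  -- Inverting `ε` put the monomials of degree `D` into the span `U` of the lower ones. So `U` is a
  -- nonzero finitely generated module stable under multiplication by `y t`.
  have hint : IsIntegral F (y t) := by
    refine isIntegral_of_smul_mem_submodule (M := Ω) U ?_ hfg (y t) ?_
    · rw [Submodule.ne_bot_iff]
      refine ⟨1, ?_, one_ne_zero⟩
      have := hle 0 (by simp)
      simpa using this
    · intro x hx
      induction hx using Submodule.span_induction with
      | mem x hx =>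
        obtain ⟨κ, hκ, rfl⟩ := hx
        have h1 : y t • ∏ s, y s ^ κ s = ∏ s, y s ^ (κ + Finsupp.single t 1 : Fin n →₀ ℕ) s := by
          simp only [Finsupp.add_apply, pow_add, Finset.prod_mul_distrib, smul_eq_mul]
          rw [mul_comm]
          congr 1
          rw [Finset.prod_eq_single t]
          · simp
          · intro s _ hs
            simp [Ne.symm hs]
          · simp
        rw [h1]
        apply hle
        rw [map_add, Finsupp.degree_single]
        omega
      | zero => simp
      | add x z _ _ hx hz => rw [smul_add]; exact U.add_mem hx hz
      | smul a x _ hx => rw [smul_comm]; exact U.smul_mem _ hx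
  exact hint.isAlgebraic

theorem homogeneousComponent_mul_of_isHomogeneous {n D a : ℕ} (f : MvPolynomial (Fin n) ℂ)
    {g : MvPolynomial (Fin n) ℂ} (hg : g.IsHomogeneous a) :
    MvPolynomial.homogeneousComponent D (f * g) =
      if a ≤ D then MvPolynomial.homogeneousComponent (D - a) f * g else 0 := by
  classical
  have h1 : ∀ k, MvPolynomial.homogeneousComponent D (MvPolynomial.homogeneousComponent k f * g) =
      if k + a = D then MvPolynomial.homogeneousComponent k f * g else 0 := by
    intro k
    rw [MvPolynomial.homogeneousComponent_of_mem
      ((MvPolynomial.mem_homogeneousSubmodule _ _).mpr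
        ((MvPolynomial.homogeneousComponent_isHomogeneous k f).mul hg))]
    simp [eq_comm]
  conv_lhs => rw [← MvPolynomial.sum_homogeneousComponent f, Finset.sum_mul, map_sum]
  rw [Finset.sum_congr rfl fun k _ => h1 k]
  split_ifs with h
  · by_cases hk : D - a < f.totalDegree + 1
    · rw [Finset.sum_eq_single (D - a)]
      · rw [if_pos (by omega)]
      · intro k _ hk; rw [if_neg (by omega)]
      · intro hk'; exact absurd (Finset.mem_range.mpr hk) hk'
    · rw [MvPolynomial.homogeneousComponent_eq_zero _ _ (by omega), zero_mul]
      refine Finset.sum_eq_zero fun k hk' => ?_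
      rw [if_neg]
      have := Finset.mem_range.mp hk'
      omega
  · refine Finset.sum_eq_zero fun k _ => if_neg (by omega)

/-- If homogeneous forms have only the trivial common zero, then all monomials of some degree are
combinations of them with homogeneous coefficients. -/
theorem exists_monomial_combination {n : ℕ} {τ : Type} [Fintype τ] (a : τ → ℕ)
    (f : τ → MvPolynomial (Fin n) ℂ) (hf : ∀ j, (f j).IsHomogeneous (a j))
    (hzero : ∀ y : Fin n → ℂ, (∀ j, MvPolynomial.eval y (f j) = 0) → y = 0) :
    ∃ D, 0 < D ∧ ∃ c : {m : Fin n →₀ ℕ // m.degree = D} → τ → MvPolynomial (Fin n) ℂ,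
      (∀ μ j, ∀ q : MvPolynomial (Fin n) ℂ, q.IsHomogeneous (a j) →
        (c μ j * q).IsHomogeneous D) ∧
      (∀ μ j, (c μ j).IsHomogeneous (D - a j)) ∧
      ∀ μ, MvPolynomial.monomial μ.1 1 = ∑ j, c μ j * f j := by
  classical
  let I : Ideal (MvPolynomial (Fin n) ℂ) := Ideal.span (Set.range f)
  -- Nullstellensatz: every coordinate vanishes on the zero set, which contains at most the origin.
  have hX : ∀ t, (MvPolynomial.X t : MvPolynomial (Fin n) ℂ) ∈ I.radical := by
    intro t
    rw [← MvPolynomial.vanishingIdeal_zeroLocus_eq_radical (K := ℂ)]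
    rw [MvPolynomial.mem_vanishingIdeal_iff]
    intro y hy
    have : y = 0 := hzero y fun j => by
      have := hy (f j) (Ideal.subset_span ⟨j, rfl⟩)
      rwa [MvPolynomial.aeval_eq_eval] at this
    simp [this]
  obtain ⟨D, hD⟩ := Ideal.exists_radical_pow_le_of_fg I (IsNoetherian.noetherian _)
  refine ⟨D + 1, Nat.succ_pos _, ?_⟩
  have hmem : ∀ μ : {m : Fin n →₀ ℕ // m.degree = D + 1},
      (MvPolynomial.monomial μ.1 1 : MvPolynomial (Fin n) ℂ) ∈ I := by
    intro μ
    have h1 : (MvPolynomial.monomial μ.1 1 : MvPolynomial (Fin n) ℂ) ∈ I.radical ^ (D + 1) := by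
      rw [MvPolynomial.monomial_eq, map_one, one_mul, Finsupp.prod_fintype _ _ (by simp),
        show I.radical ^ (D + 1) = ∏ t, I.radical ^ μ.1 t by
          rw [Finset.prod_pow_eq_pow_sum, ← finsupp_degree_eq_sum, μ.2]]
      exact Ideal.prod_mem_prod fun t _ => Ideal.pow_mem_pow (hX t) _
    exact hD (Ideal.pow_le_pow_right (Nat.le_succ D) h1)
  have hex : ∀ μ : {m : Fin n →₀ ℕ // m.degree = D + 1}, ∃ c : τ → MvPolynomial (Fin n) ℂ,
      ∑ j, c j * f j = MvPolynomial.monomial μ.1 1 := fun μ =>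
    (Ideal.mem_span_range_iff_exists_fun).mp (hmem μ)
  choose c hc using hex
  -- Only the part of complementary degree of each coefficient matters. If `a j > D + 1`, the
  -- truncated difference would wrongly select the constant term, so the coefficient is set to 0.
  refine ⟨fun μ j => if a j ≤ D + 1 then
    MvPolynomial.homogeneousComponent (D + 1 - a j) (c μ j) else 0, ?_, ?_, ?_⟩
  · intro μ j q hq
    dsimp only
    split_ifs with h
    · have := (MvPolynomial.homogeneousComponent_isHomogeneous (D + 1 - a j) (c μ j)).mul hq
      rwa [Nat.sub_add_cancel h] at this
    · rw [zero_mul]; exact MvPolynomial.isHomogeneous_zero _ _ _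
  · intro μ j
    dsimp only
    split_ifs with h
    · exact MvPolynomial.homogeneousComponent_isHomogeneous _ _
    · exact MvPolynomial.isHomogeneous_zero _ _ _
  · intro μ
    have h1 := congrArg (MvPolynomial.homogeneousComponent (D + 1)) (hc μ)
    rw [MvPolynomial.homogeneousComponent_eq_self (MvPolynomial.isHomogeneous_monomial 1 μ.2),
      map_sum] at h1
    rw [← h1]
    refine Finset.sum_congr rfl fun j _ => ?_
    rw [homogeneousComponent_mul_of_isHomogeneous _ (hf j)]
    dsimp only
    split_ifs
    · rfl
    · rw [zero_mul]

end

section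

/-! ### Points in general position on an irreducible cone -/

/-- A nonempty set of nonzero vectors whose vanishing ideal is prime. -/
structure IsIrreducibleCone {n : ℕ} (C : Set (Fin n → ℂ)) : Prop where
  nonempty : C.Nonempty
  ne_zero : ∀ y ∈ C, y ≠ 0
  irreducible : ∀ f g : MvPolynomial (Fin n) ℂ, (∃ y ∈ C, MvPolynomial.eval y f ≠ 0) →
    (∃ y ∈ C, MvPolynomial.eval y g ≠ 0) →
    ∃ y ∈ C, MvPolynomial.eval y f ≠ 0 ∧ MvPolynomial.eval y g ≠ 0

/-- A function of several vectors that is polynomial in each of them. -/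
def IsSeparatelyPolynomial {n : ℕ} {ι : Type} [DecidableEq ι] (G : (ι → Fin n → ℂ) → ℂ) : Prop :=
  ∀ Y l, ∃ f : MvPolynomial (Fin n) ℂ, ∀ v, G (Function.update Y l v) = MvPolynomial.eval v f

namespace IsSeparatelyPolynomial

variable {n : ℕ} {ι κ : Type} [DecidableEq ι]

theorem const (c : ℂ) : IsSeparatelyPolynomial fun _ : ι → Fin n → ℂ => c :=
  fun _ _ => ⟨MvPolynomial.C c, by simp⟩

theorem add {G H : (ι → Fin n → ℂ) → ℂ} (hG : IsSeparatelyPolynomial G)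
    (hH : IsSeparatelyPolynomial H) : IsSeparatelyPolynomial fun Y => G Y + H Y := fun Y l => by
  obtain ⟨f, hf⟩ := hG Y l
  obtain ⟨g, hg⟩ := hH Y l
  exact ⟨f + g, fun v => by rw [map_add, ← hf, ← hg]⟩

theorem mul {G H : (ι → Fin n → ℂ) → ℂ} (hG : IsSeparatelyPolynomial G)
    (hH : IsSeparatelyPolynomial H) : IsSeparatelyPolynomial fun Y => G Y * H Y := fun Y l => by
  obtain ⟨f, hf⟩ := hG Y l
  obtain ⟨g, hg⟩ := hH Y l
  exact ⟨f * g, fun v => by rw [map_mul, ← hf, ← hg]⟩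

theorem eval (g : MvPolynomial (Fin n) ℂ) (l : ι) :
    IsSeparatelyPolynomial fun Y : ι → Fin n → ℂ => MvPolynomial.eval (Y l) g := fun Y k => by
  by_cases h : k = l
  · subst h
    exact ⟨g, fun v => by simp⟩
  · exact ⟨MvPolynomial.C (MvPolynomial.eval (Y l) g), fun v => by
      simp [Function.update_of_ne (Ne.symm h)]⟩

theorem polynomial {G : κ → (ι → Fin n → ℂ) → ℂ} (hG : ∀ k, IsSeparatelyPolynomial (G k))
    (f : MvPolynomial κ ℂ) :
    IsSeparatelyPolynomial fun Y => MvPolynomial.eval (fun k => G k Y) f := by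
  induction f using MvPolynomial.induction_on with
  | C a => simpa using const a
  | add p q hp hq => simpa using hp.add hq
  | mul_X p k hp => simpa using hp.mul (hG k)

theorem sum (s : Finset κ) {G : κ → (ι → Fin n → ℂ) → ℂ}
    (hG : ∀ k ∈ s, IsSeparatelyPolynomial (G k)) :
    IsSeparatelyPolynomial fun Y => ∑ k ∈ s, G k Y := by
  classical
  induction s using Finset.induction_on with
  | empty => simpa using const 0
  | insert a s ha ih =>
    simp only [Finset.sum_insert ha]
    exact (hG a (Finset.mem_insert_self a s)).add
      (ih fun k hk => hG k (Finset.mem_insert_of_mem hk))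

theorem prod (s : Finset κ) {G : κ → (ι → Fin n → ℂ) → ℂ}
    (hG : ∀ k ∈ s, IsSeparatelyPolynomial (G k)) :
    IsSeparatelyPolynomial fun Y => ∏ k ∈ s, G k Y := by
  classical
  induction s using Finset.induction_on with
  | empty => simpa using const 1
  | insert a s ha ih =>
    simp only [Finset.prod_insert ha]
    exact (hG a (Finset.mem_insert_self a s)).mul
      (ih fun k hk => hG k (Finset.mem_insert_of_mem hk))

theorem det [Fintype κ] [DecidableEq κ] {G : κ → κ → (ι → Fin n → ℂ) → ℂ}
    (hG : ∀ k j, IsSeparatelyPolynomial (G k j)) :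
    IsSeparatelyPolynomial fun Y => (Matrix.of fun k j => G k j Y).det := by
  simp only [Matrix.det_apply']
  exact sum _ fun σ _ => (const _).mul (prod _ fun k _ => hG _ _)

end IsSeparatelyPolynomial

namespace IsIrreducibleCone

variable {n : ℕ} {C : Set (Fin n → ℂ)} {ι : Type} [Fintype ι] [DecidableEq ι]

/-- Powers of an irreducible cone are irreducible. -/
theorem exists_both_ne_zero (hC : IsIrreducibleCone C) {G H : (ι → Fin n → ℂ) → ℂ}
    (hG : IsSeparatelyPolynomial G) (hH : IsSeparatelyPolynomial H)
    (hG0 : ∃ Y, (∀ l, Y l ∈ C) ∧ G Y ≠ 0) (hH0 : ∃ Y, (∀ l, Y l ∈ C) ∧ H Y ≠ 0) :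
    ∃ Y, (∀ l, Y l ∈ C) ∧ G Y ≠ 0 ∧ H Y ≠ 0 := by
  -- Start from separate witnesses `Y` for `G` and `Z` for `H` and make them agree in one entry at a
  -- time: with the other entries fixed, both functions are polynomials in that entry, and
  -- irreducibility of `C` gives a common value.
  have key : ∀ s : Finset ι, ∃ Y Z, (∀ l, Y l ∈ C) ∧ (∀ l, Z l ∈ C) ∧ (∀ l ∈ s, Y l = Z l) ∧
      G Y ≠ 0 ∧ H Z ≠ 0 := by
    intro s
    induction s using Finset.induction_on with
    | empty =>
      obtain ⟨Y, hY, hY0⟩ := hG0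
      obtain ⟨Z, hZ, hZ0⟩ := hH0
      exact ⟨Y, Z, hY, hZ, by simp, hY0, hZ0⟩
    | insert a s ha ih =>
      obtain ⟨Y, Z, hY, hZ, hYZ, hY0, hZ0⟩ := ih
      obtain ⟨f, hf⟩ := hG Y a
      obtain ⟨g, hg⟩ := hH Z a
      obtain ⟨v, hv, hv1, hv2⟩ := hC.irreducible f g
        ⟨Y a, hY a, by rwa [← hf, Function.update_eq_self]⟩
        ⟨Z a, hZ a, by rwa [← hg, Function.update_eq_self]⟩
      refine ⟨Function.update Y a v, Function.update Z a v, ?_, ?_, ?_, by rwa [hf], by rwa [hg]⟩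
      · intro l
        by_cases h : l = a
        · subst h; simpa using hv
        · simpa [h] using hY l
      · intro l
        by_cases h : l = a
        · subst h; simpa using hv
        · simpa [h] using hZ l
      · intro l hl
        by_cases h : l = a
        · subst h; simp
        · simpa [h] using hYZ l ((Finset.mem_insert.mp hl).resolve_left h)
  obtain ⟨Y, Z, hY, hZ, hYZ, hY0, hZ0⟩ := key Finset.univ
  have : Y = Z := funext fun l => hYZ l (Finset.mem_univ l)
  exact ⟨Y, hY, hY0, this ▸ hZ0⟩

theorem exists_all_ne_zero (hC : IsIrreducibleCone C) {κ : Type} (s : Finset κ)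
    (G : κ → (ι → Fin n → ℂ) → ℂ) (hG : ∀ k ∈ s, IsSeparatelyPolynomial (G k))
    (hG0 : ∀ k ∈ s, ∃ Y, (∀ l, Y l ∈ C) ∧ G k Y ≠ 0) :
    ∃ Y, (∀ l, Y l ∈ C) ∧ ∀ k ∈ s, G k Y ≠ 0 := by
  classical
  induction s using Finset.induction_on with
  | empty =>
    obtain ⟨y, hy⟩ := hC.nonempty
    exact ⟨fun _ => y, fun _ => hy, by simp⟩
  | insert a s ha ih =>
    obtain ⟨Y, hY, hY0⟩ := ih (fun k hk => hG k (Finset.mem_insert_of_mem hk))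
      (fun k hk => hG0 k (Finset.mem_insert_of_mem hk))
    obtain ⟨Z, hZ, h1, h2⟩ := hC.exists_both_ne_zero (hG a (Finset.mem_insert_self a s))
      (IsSeparatelyPolynomial.prod s fun k hk => hG k (Finset.mem_insert_of_mem hk))
      (hG0 a (Finset.mem_insert_self a s)) ⟨Y, hY, Finset.prod_ne_zero_iff.mpr hY0⟩
    refine ⟨Z, hZ, fun k hk => ?_⟩
    rcases Finset.mem_insert.mp hk with rfl | hk
    · exact h1
    · exact Finset.prod_ne_zero_iff.mp h2 k hk

/-- If some functions are algebraically independent on `C`, then their values at several points of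
`C` are algebraically independent. -/
theorem exists_eval_ne_zero {m : ℕ} {lam : Fin m → MvPolynomial (Fin n) ℂ}
    (hlam : ∀ f : MvPolynomial (Fin m) ℂ, f ≠ 0 →
      ∃ y ∈ C, MvPolynomial.eval (fun u => MvPolynomial.eval y (lam u)) f ≠ 0)
    (hC : C.Nonempty)
    {f : MvPolynomial (ι × Fin m) ℂ} (hf : f ≠ 0) :
    ∃ Y : ι → Fin n → ℂ, (∀ l, Y l ∈ C) ∧
      MvPolynomial.eval (fun k => MvPolynomial.eval (Y k.1) (lam k.2)) f ≠ 0 := by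
  obtain ⟨Z₀, hZ₀⟩ : ∃ Z : ι × Fin m → ℂ, MvPolynomial.eval Z f ≠ 0 := by
    by_contra! h
    exact hf (MvPolynomial.funext fun Z => by rw [h, map_zero])
  -- A point `Z₀` where `f` is nonzero is replaced block by block: with the other blocks frozen, `f`
  -- is a nonzero polynomial in one block, to which `hlam` applies.
  have key : ∀ s : Finset ι, ∃ (Y : ι → Fin n → ℂ) (Z : ι × Fin m → ℂ), (∀ l, Y l ∈ C) ∧
      (∀ l ∈ s, ∀ u, Z (l, u) = MvPolynomial.eval (Y l) (lam u)) ∧ MvPolynomial.eval Z f ≠ 0 := by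
    intro s
    induction s using Finset.induction_on with
    | empty =>
      obtain ⟨y, hy⟩ := hC
      exact ⟨fun _ => y, Z₀, fun _ => hy, by simp, hZ₀⟩
    | insert a s ha ih =>
      obtain ⟨Y, Z, hY, hYZ, hZ⟩ := ih
      let F : MvPolynomial (Fin m) ℂ := MvPolynomial.bind₁ (fun k : ι × Fin m =>
        if k.1 = a then MvPolynomial.X k.2 else MvPolynomial.C (Z k)) f
      have hF : ∀ z : Fin m → ℂ, MvPolynomial.eval z F =
          MvPolynomial.eval (fun k => if k.1 = a then z k.2 else Z k) f := by
        intro z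
        simp only [F, MvPolynomial.eval, MvPolynomial.eval₂Hom_bind₁]
        congr 2
        funext k
        split_ifs <;> simp
      have hF0 : F ≠ 0 := by
        intro h0
        apply hZ
        have := hF fun u => Z (a, u)
        rw [h0, map_zero] at this
        rw [this]
        congr 2
        funext k
        split_ifs with h
        · rw [← h]
        · rfl
      obtain ⟨y, hy, hy0⟩ := hlam F hF0
      rw [hF] at hy0
      refine ⟨Function.update Y a y, _, ?_, ?_, hy0⟩
      · intro l
        by_cases h : l = a
        · subst h; simpa using hy
        · simpa [h] using hY l
      · intro l hl u
        by_cases h : l = a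
        · subst h; simp
        · simpa [h] using hYZ l ((Finset.mem_insert.mp hl).resolve_left h) u
  obtain ⟨Y, Z, hY, hYZ, hZ⟩ := key Finset.univ
  refine ⟨Y, hY, ?_⟩
  convert hZ using 2
  congr 1
  funext k
  exact (hYZ k.1 (Finset.mem_univ _) k.2).symm

end IsIrreducibleCone

/-- There are forms of degree `a`, indexed by `ι`, that are linearly independent as functions
on `C`. -/
def HasIndependentForms {n : ℕ} (C : Set (Fin n → ℂ)) (a : ℕ) (ι : Type) [Fintype ι] : Prop :=
  ∃ g : ι → MvPolynomial (Fin n) ℂ, (∀ l, (g l).IsHomogeneous a) ∧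
    ∀ x : ι → ℂ, (∀ y ∈ C, ∑ l, x l * MvPolynomial.eval y (g l) = 0) → x = 0

/-- The points `Y l` impose independent conditions on forms of degree `a`. -/
def ImposeIndependentConditions {n : ℕ} {ι : Type} [DecidableEq ι] (a : ℕ)
    (Y : ι → Fin n → ℂ) : Prop :=
  ∃ γ : ι → MvPolynomial (Fin n) ℂ, (∀ l, (γ l).IsHomogeneous a) ∧
    ∀ l m, MvPolynomial.eval (Y l) (γ m) = if l = m then 1 else 0

section Forms

variable {n : ℕ} {C : Set (Fin n → ℂ)} {ι : Type} [Fintype ι] [DecidableEq ι] {a : ℕ}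

theorem ImposeIndependentConditions.of_det {Y : ι → Fin n → ℂ} (g : ι → MvPolynomial (Fin n) ℂ)
    (hg : ∀ l, (g l).IsHomogeneous a)
    (h : (Matrix.of fun l m => MvPolynomial.eval (Y l) (g m)).det ≠ 0) :
    ImposeIndependentConditions a Y := by
  set A : Matrix ι ι ℂ := Matrix.of fun l m => MvPolynomial.eval (Y l) (g m) with hA
  refine ⟨fun m => ∑ k, MvPolynomial.C (A⁻¹ k m) * g k, ?_, ?_⟩
  · intro m
    exact MvPolynomial.IsHomogeneous.sum _ _ _ fun k _ => (hg k).C_mul _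
  · intro l m
    have h1 : (A * A⁻¹) l m = (1 : Matrix ι ι ℂ) l m := by
      rw [Matrix.mul_nonsing_inv _ (Ne.isUnit h)]
    rw [Matrix.mul_apply, Matrix.one_apply] at h1
    rw [← h1, map_sum]
    refine Finset.sum_congr rfl fun k _ => ?_
    rw [map_mul, MvPolynomial.eval_C, mul_comm]
    rfl

theorem ImposeIndependentConditions.hasIndependentForms {Y : ι → Fin n → ℂ} (hY : ∀ l, Y l ∈ C)
    (h : ImposeIndependentConditions a Y) : HasIndependentForms C a ι := by
  obtain ⟨γ, hγ, hd⟩ := h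
  refine ⟨γ, hγ, fun x hx => funext fun l => ?_⟩
  have := hx (Y l) (hY l)
  simpa [hd] using this

theorem exists_det_ne_zero {g : ι → MvPolynomial (Fin n) ℂ}
    (hg : ∀ x : ι → ℂ, (∀ y ∈ C, ∑ l, x l * MvPolynomial.eval y (g l) = 0) → x = 0) :
    ∃ Y : ι → Fin n → ℂ, (∀ l, Y l ∈ C) ∧
      (Matrix.of fun l m => MvPolynomial.eval (Y l) (g m)).det ≠ 0 := by
  let ev : (Fin n → ℂ) → (ι → ℂ) := fun y l => MvPolynomial.eval y (g l)
  -- If the evaluation vectors lay in a hyperplane, its equation would be a linear relation between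
  -- the forms on `C`.
  have hspan : Submodule.span ℂ (ev '' C) = ⊤ := by
    by_contra hne
    obtain ⟨φ, hφ, hle⟩ := Submodule.exists_le_ker_of_lt_top _ (lt_top_iff_ne_top.mpr hne)
    apply hφ
    have hφx : ∀ z : ι → ℂ, φ z = ∑ l, φ (Pi.single l 1) * z l := by
      intro z
      conv_lhs => rw [LinearMap.pi_apply_eq_sum_univ φ z]
      refine Finset.sum_congr rfl fun l _ => ?_
      rw [smul_eq_mul, mul_comm]
      congr 2
      funext k
      simp [Pi.single_apply, eq_comm]
    have := hg (fun l => φ (Pi.single l 1)) (by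
      intro y hy
      have h1 : φ (ev y) = 0 := hle (Submodule.subset_span ⟨y, hy, rfl⟩)
      rw [hφx] at h1
      exact h1)
    ext l
    simpa using congrFun this l
  obtain ⟨b, hbC, hbs, hbl⟩ := exists_linearIndependent ℂ (ev '' C)
  rw [hspan] at hbs
  let B : Module.Basis b ℂ (ι → ℂ) := Module.Basis.mk hbl (by rw [Subtype.range_coe, hbs])
  have : Finite b := Module.Finite.finite_basis B
  have := Fintype.ofFinite b
  have hcard : Fintype.card ι = Fintype.card b := by
    rw [← Module.finrank_eq_card_basis B, Module.finrank_fintype_fun_eq_card]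
  let e : ι ≃ b := Fintype.equivOfCardEq hcard
  have hpre : ∀ l, ∃ y ∈ C, ev y = (e l : ι → ℂ) := fun l => hbC (e l).2
  choose Y hYC hY using hpre
  refine ⟨Y, hYC, ?_⟩
  have h1 : LinearIndependent ℂ fun l => ((e l : b) : ι → ℂ) := hbl.comp e e.injective
  have h2 : LinearIndependent ℂ (Matrix.of fun l m => MvPolynomial.eval (Y l) (g m)).row := by
    convert h1 using 1
    funext l
    exact hY l
  rw [Matrix.linearIndependent_rows_iff_isUnit, Matrix.isUnit_iff_isUnit_det] at h2
  exact h2.ne_zero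

theorem HasIndependentForms.comp_injective {κ : Type} [Fintype κ] (h : HasIndependentForms C a ι)
    (f : κ → ι) (hf : Function.Injective f) : HasIndependentForms C a κ := by
  obtain ⟨g, hg, hx⟩ := h
  refine ⟨g ∘ f, fun l => hg _, fun x hx' => ?_⟩
  have h1 := hx (Function.extend f x 0) (by
    intro y hy
    rw [← hx' y hy]
    symm
    have h2 : ∀ l ∈ Finset.univ, l ∉ Finset.univ.image f →
        Function.extend f x 0 l * MvPolynomial.eval y (g l) = 0 := by
      intro l _ hl
      rw [Function.extend_apply' _ _ _ (by simpa using hl)]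
      simp
    rw [← Finset.sum_subset (Finset.subset_univ _) h2, Finset.sum_image (fun _ _ _ _ h => hf h)]
    refine Finset.sum_congr rfl fun l _ => ?_
    rw [hf.extend_apply]; rfl)
  funext l
  have := congrFun h1 (f l)
  rwa [hf.extend_apply] at this

theorem HasIndependentForms.of_card_le {κ : Type} [Fintype κ] (h : HasIndependentForms C a ι)
    (hc : Fintype.card κ ≤ Fintype.card ι) : HasIndependentForms C a κ := by
  obtain ⟨f⟩ := Function.Embedding.nonempty_of_card_le hc
  exact h.comp_injective f f.injective

-- Multiplication by a coordinate that does not vanish identically on `C` preserves independence,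
-- because `C` is irreducible.
omit [DecidableEq ι] in
theorem HasIndependentForms.succ (hC : IsIrreducibleCone C) (h : HasIndependentForms C a ι) :
    HasIndependentForms C (a + 1) ι := by
  obtain ⟨g, hg, hx⟩ := h
  obtain ⟨y₀, hy₀⟩ := hC.nonempty
  obtain ⟨t, ht⟩ : ∃ t, y₀ t ≠ 0 := by
    by_contra! h0
    exact hC.ne_zero y₀ hy₀ (funext h0)
  refine ⟨fun l => g l * MvPolynomial.X t, fun l => (hg l).mul (MvPolynomial.isHomogeneous_X _ _),
    fun x hx' => hx x fun y hy => ?_⟩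
  by_contra hne
  have hev : ∀ y, MvPolynomial.eval y (∑ l, MvPolynomial.C (x l) * g l) =
      ∑ l, x l * MvPolynomial.eval y (g l) := by simp
  obtain ⟨z, hz, hz1, hz2⟩ := hC.irreducible (∑ l, MvPolynomial.C (x l) * g l) (MvPolynomial.X t)
    ⟨y, hy, by rwa [hev]⟩ ⟨y₀, hy₀, by simpa using ht⟩
  have h1 := hx' z hz
  simp only [map_mul, ← mul_assoc, ← Finset.sum_mul] at h1
  rw [hev] at hz1
  exact (mul_ne_zero hz1 hz2) h1

omit [DecidableEq ι] in
theorem HasIndependentForms.of_le (hC : IsIrreducibleCone C) (h : HasIndependentForms C a ι) {a' : ℕ}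
    (ha : a ≤ a') : HasIndependentForms C a' ι := by
  induction a', ha using Nat.le_induction with
  | base => exact h
  | succ k _ ih => exact ih.succ hC

/-- An irreducible cone spanning a space of dimension `e + 1` carries at least `a e + 1` independent
forms of degree `a`. -/
theorem HasIndependentForms.pow_degree (hC : IsIrreducibleCone C) {e : ℕ}
    (h : HasIndependentForms C 1 (Fin (e + 1))) (a : ℕ) :
    HasIndependentForms C a (Fin (a * e + 1)) := by
  classical
  obtain ⟨ℓ, hℓ, hx⟩ := h
  obtain ⟨Y₀, hY₀, hdet₀⟩ := exists_det_ne_zero hx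
  obtain ⟨y₀, hy₀⟩ := hC.nonempty
  -- The points are chosen in linearly general position: any `e + 1` of the `a e + 1` points are
  -- linearly independent.
  obtain ⟨Y, hY, hdet⟩ := hC.exists_all_ne_zero
    (Finset.univ.filter fun σ : Fin (e + 1) → Fin (a * e + 1) => Function.Injective σ)
    (fun σ Y => (Matrix.of fun s t => MvPolynomial.eval (Y (σ s)) (ℓ t)).det)
    (fun σ _ => IsSeparatelyPolynomial.det fun s t => IsSeparatelyPolynomial.eval (ℓ t) (σ s))
    (by
      intro σ hσ
      have hσ' : Function.Injective σ := by simpa using hσ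
      refine ⟨Function.extend σ Y₀ fun _ => y₀, ?_, ?_⟩
      · intro l
        by_cases h : ∃ s, σ s = l
        · obtain ⟨s, rfl⟩ := h
          rw [hσ'.extend_apply]
          exact hY₀ s
        · rw [Function.extend_apply' _ _ _ h]
          exact hy₀
      · simp only [hσ'.extend_apply]
        exact hdet₀)
  refine ImposeIndependentConditions.hasIndependentForms (Y := Y) hY ?_
  have hex : ∀ l, ∃ F : MvPolynomial (Fin n) ℂ, F.IsHomogeneous a ∧
      ∀ m, MvPolynomial.eval (Y m) F = if m = l then 1 else 0 := by
    intro l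
    -- The `a e` points other than `l` are divided into `a` blocks of `e` points. For each block
    -- some linear form vanishes on it and equals 1 at `Y l`; the product of these forms separates
    -- `Y l` from all the other points.
    have hcard : Fintype.card {m : Fin (a * e + 1) // m ≠ l} = Fintype.card (Fin a × Fin e) := by
      simp
    let E := Fintype.equivOfCardEq hcard
    let σ : Fin a → Fin (e + 1) → Fin (a * e + 1) := fun c =>
      Fin.cons l fun s => (E.symm (c, s)).1
    have hσ : ∀ c, Function.Injective (σ c) := by
      intro c
      rw [Fin.cons_injective_iff]
      refine ⟨?_, ?_⟩
      · rintro ⟨s, hs⟩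
        exact (E.symm (c, s)).2 hs
      · intro s s' hs
        have := E.symm.injective (Subtype.ext hs)
        simpa using this
    have hh : ∀ c, ∃ F : MvPolynomial (Fin n) ℂ, F.IsHomogeneous 1 ∧
        ∀ s, MvPolynomial.eval (Y (σ c s)) F = if s = 0 then 1 else 0 := by
      intro c
      obtain ⟨γ, hγ, hd⟩ := ImposeIndependentConditions.of_det (Y := fun s => Y (σ c s)) ℓ hℓ
        (hdet (σ c) (by simpa using hσ c))
      exact ⟨γ 0, hγ 0, fun s => hd s 0⟩
    choose F hF hFs using hh
    refine ⟨∏ c, F c, ?_, ?_⟩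
    · have := MvPolynomial.IsHomogeneous.prod Finset.univ F (fun _ => 1) fun c _ => hF c
      simpa using this
    · intro m
      rw [map_prod]
      split_ifs with hm
      · subst hm
        refine Finset.prod_eq_one fun c _ => ?_
        have := hFs c 0
        simpa [σ] using this
      · let cs := E ⟨m, hm⟩
        refine Finset.prod_eq_zero (Finset.mem_univ cs.1) ?_
        have := hFs cs.1 cs.2.succ
        simpa [σ, cs] using this
  choose γ hγ hd using hex
  exact ⟨γ, hγ, fun l m => hd m l⟩

/-- Monomials of degree `a` in algebraically independent linear forms are independent. -/
theorem hasIndependentForms_monomials {m : ℕ} {lam : Fin m → MvPolynomial (Fin n) ℂ}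
    (hlam1 : ∀ u, (lam u).IsHomogeneous 1)
    (hlam : ∀ f : MvPolynomial (Fin m) ℂ, f ≠ 0 →
      ∃ y ∈ C, MvPolynomial.eval (fun u => MvPolynomial.eval y (lam u)) f ≠ 0) (a : ℕ) :
    HasIndependentForms C a {κ : Fin m →₀ ℕ // κ.degree = a} := by
  classical
  refine ⟨fun κ => ∏ u, lam u ^ κ.1 u, ?_, ?_⟩
  · intro κ
    have := MvPolynomial.IsHomogeneous.prod Finset.univ (fun u => lam u ^ κ.1 u) (fun u => 1 * κ.1 u)
      fun u _ => (hlam1 u).pow _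
    simp only [one_mul] at this
    rwa [← finsupp_degree_eq_sum, κ.2] at this
  · intro x hx
    by_contra hne
    let f : MvPolynomial (Fin m) ℂ := ∑ κ : {κ : Fin m →₀ ℕ // κ.degree = a},
      MvPolynomial.monomial κ.1 (x κ)
    have hf : ∀ κ : {κ : Fin m →₀ ℕ // κ.degree = a}, f.coeff κ.1 = x κ := by
      intro κ
      rw [MvPolynomial.coeff_sum, Finset.sum_eq_single κ]
      · simp
      · intro ν _ hν
        rw [MvPolynomial.coeff_monomial, if_neg fun h => hν (Subtype.ext h)]
      · simp
    have hf0 : f ≠ 0 := by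
      intro h0
      apply hne
      funext κ
      rw [← hf, h0, MvPolynomial.coeff_zero]; rfl
    obtain ⟨y, hy, hy0⟩ := hlam f hf0
    apply hy0
    rw [← hx y hy, map_sum]
    refine Finset.sum_congr rfl fun κ _ => ?_
    rw [MvPolynomial.eval_monomial, Finsupp.prod_fintype _ _ (by simp), map_prod]
    simp

theorem card_monomials_two (m : ℕ) :
    (m + 1).choose 2 ≤ Fintype.card {κ : Fin m →₀ ℕ // κ.degree = 2} := by
  classical
  have h1 : Fintype.card (Sym (Fin m) 2) = (m + 1).choose 2 := by
    rw [Sym.card_sym_eq_choose]; simp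
  rw [← h1]
  refine Fintype.card_le_of_injective (fun s => ⟨Multiset.toFinsupp s.1, ?_⟩) ?_
  · have := Finsupp.card_toMultiset (Multiset.toFinsupp s.1)
    rw [Multiset.toFinsupp_toMultiset, s.2] at this
    exact this.symm
  · intro s t hst
    have := congrArg Subtype.val hst
    exact Subtype.ext (Multiset.toFinsupp.injective this)

theorem exists_linearMap_eval {f : MvPolynomial (Fin n) ℂ} (hf : f.IsHomogeneous 1) :
    ∃ φ : (Fin n → ℂ) →ₗ[ℂ] ℂ, ∀ y, MvPolynomial.eval y f = φ y := by
  have h1 : f ∈ Submodule.span ℂ (Set.range MvPolynomial.X) := by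
    rw [← MvPolynomial.homogeneousSubmodule_one_eq_span_X]
    exact hf
  induction h1 using Submodule.span_induction with
  | mem x hx =>
    obtain ⟨t, rfl⟩ := hx
    exact ⟨LinearMap.proj t, by simp⟩
  | zero => exact ⟨0, by simp⟩
  | add x y hx hy ihx ihy =>
    rw [← MvPolynomial.homogeneousSubmodule_one_eq_span_X] at hx hy
    obtain ⟨φ, hφ⟩ := ihx hx
    obtain ⟨ψ, hψ⟩ := ihy hy
    exact ⟨φ + ψ, by simp [hφ, hψ]⟩
  | smul a x hx ihx =>
    rw [← MvPolynomial.homogeneousSubmodule_one_eq_span_X] at hx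
    obtain ⟨φ, hφ⟩ := ihx hx
    exact ⟨a • φ, by simp [hφ]⟩

theorem exists_linearForm (φ : (Fin n → ℂ) →ₗ[ℂ] ℂ) :
    ∃ f : MvPolynomial (Fin n) ℂ, f.IsHomogeneous 1 ∧ ∀ y, MvPolynomial.eval y f = φ y := by
  classical
  refine ⟨∑ t, MvPolynomial.C (φ (Pi.single t 1)) * MvPolynomial.X t, ?_, ?_⟩
  · exact MvPolynomial.IsHomogeneous.sum _ _ _ fun t _ => MvPolynomial.isHomogeneous_C_mul_X _ _
  · intro y
    rw [LinearMap.pi_apply_eq_sum_univ φ y, map_sum]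
    refine Finset.sum_congr rfl fun t _ => ?_
    rw [map_mul, MvPolynomial.eval_C, MvPolynomial.eval_X, smul_eq_mul, mul_comm]
    congr 2
    funext k
    simp [Pi.single_apply, eq_comm]

theorem ImposeIndependentConditions.linearIndependent {Y : ι → Fin n → ℂ}
    (h : ImposeIndependentConditions 1 Y) : LinearIndependent ℂ Y := by
  obtain ⟨γ, hγ, hd⟩ := h
  rw [Fintype.linearIndependent_iff]
  intro x hx l
  obtain ⟨φ, hφ⟩ := exists_linearMap_eval (hγ l)
  have := congrArg φ hx
  simp only [map_sum, map_smul, map_zero] at this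
  simp only [← hφ, hd] at this
  simpa using this

theorem imposeIndependentConditions_one {Y : ι → Fin n → ℂ} (h : LinearIndependent ℂ Y) :
    ImposeIndependentConditions 1 Y := by
  obtain ⟨L, hL⟩ := LinearMap.exists_leftInverse_of_injective
    (Fintype.linearCombination ℂ Y) (by
      rw [LinearMap.ker_eq_bot]
      exact h.fintypeLinearCombination_injective)
  choose γ hγ hd using fun l => exists_linearForm ((LinearMap.proj l).comp L)
  refine ⟨γ, hγ, fun l m => ?_⟩
  have h1 := congrArg (fun F => F (Pi.single l 1)) hL
  simp only [LinearMap.comp_apply, Fintype.linearCombination_apply_single, one_smul,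
    LinearMap.id_apply] at h1
  rw [hd, LinearMap.comp_apply, h1]
  simp [Pi.single_apply, eq_comm]

/-- The linear forms on an `N`-dimensional span are independent. -/
theorem hasIndependentForms_finrank_span (C : Set (Fin n → ℂ)) :
    HasIndependentForms C 1 (Fin (Module.finrank ℂ (Submodule.span ℂ C))) := by
  classical
  obtain ⟨b, hbC, hbs, hbl⟩ := exists_linearIndependent ℂ C
  have : Finite b := hbl.finite
  have := Fintype.ofFinite b
  have h1 : Module.finrank ℂ (Submodule.span ℂ C) = Fintype.card b := by
    rw [← hbs, finrank_span_set_eq_card hbl, Set.toFinset_card]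
  have h2 : HasIndependentForms C 1 b :=
    (imposeIndependentConditions_one hbl).hasIndependentForms fun l => hbC l.2
  exact h2.of_card_le (by simp [h1])

theorem HasIndependentForms.card_le_finrank_span (h : HasIndependentForms C 1 ι) :
    Fintype.card ι ≤ Module.finrank ℂ (Submodule.span ℂ C) := by
  obtain ⟨g, hg, hx⟩ := h
  obtain ⟨Y, hY, hdet⟩ := exists_det_ne_zero hx
  have h1 := (ImposeIndependentConditions.of_det g hg hdet).linearIndependent
  have h2 : LinearIndependent ℂ
      fun l => (⟨Y l, Submodule.subset_span (hY l)⟩ : Submodule.span ℂ C) :=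
    LinearIndependent.of_comp (Submodule.span ℂ C).subtype h1
  exact h2.fintype_card_le_finrank

/-- Points of an irreducible cone in general position. -/
theorem exists_general_points {β μ ξ : Type} [Fintype β] [Fintype μ] [Fintype ξ] [DecidableEq β]
    [DecidableEq μ] [DecidableEq ξ] (hC : IsIrreducibleCone C)
    (hβ : Fintype.card β = Module.finrank ℂ (Submodule.span ℂ C))
    {m : ℕ} {lam : Fin m → MvPolynomial (Fin n) ℂ}
    (hlam : ∀ f : MvPolynomial (Fin m) ℂ, f ≠ 0 →
      ∃ y ∈ C, MvPolynomial.eval (fun u => MvPolynomial.eval y (lam u)) f ≠ 0)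
    {κ : Type} (J : Finset κ) (d : κ → ℕ) (hJ : ∀ j ∈ J, HasIndependentForms C (d j) (β ⊕ μ))
    (ha : HasIndependentForms C a ((β ⊕ μ) ⊕ ξ))
    {f : MvPolynomial (((β ⊕ μ) ⊕ ξ) × Fin m) ℂ} (hf : f ≠ 0) :
    ∃ Y : (β ⊕ μ) ⊕ ξ → Fin n → ℂ, (∀ l, Y l ∈ C) ∧
      MvPolynomial.eval (fun k => MvPolynomial.eval (Y k.1) (lam k.2)) f ≠ 0 ∧
      (∀ l, ∃ c : β → ℂ, Y l = ∑ t, c t • Y (Sum.inl (Sum.inl t))) ∧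
      (∀ j ∈ J, ImposeIndependentConditions (d j) fun l => Y (Sum.inl l)) ∧
      ImposeIndependentConditions a Y := by
  obtain ⟨y₀, hy₀⟩ := hC.nonempty
  obtain ⟨ℓ, hℓ, hℓx⟩ := (hasIndependentForms_finrank_span C).of_card_le (κ := β) (by simp [hβ])
  obtain ⟨g, hg, hgx⟩ := ha
  have hJ' : ∀ j, ∃ G : β ⊕ μ → MvPolynomial (Fin n) ℂ, j ∈ J → (∀ l, (G l).IsHomogeneous (d j)) ∧
      ∀ x : β ⊕ μ → ℂ, (∀ y ∈ C, ∑ l, x l * MvPolynomial.eval y (G l) = 0) → x = 0 := by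
    intro j
    by_cases hj : j ∈ J
    · obtain ⟨G, hG⟩ := hJ j hj
      exact ⟨G, fun _ => hG⟩
    · exact ⟨0, fun h => absurd h hj⟩
  choose G hG using hJ'
  have hp1 : IsSeparatelyPolynomial fun Y : (β ⊕ μ) ⊕ ξ → Fin n → ℂ =>
      MvPolynomial.eval (fun k : ((β ⊕ μ) ⊕ ξ) × Fin m => MvPolynomial.eval (Y k.1) (lam k.2)) f :=
    IsSeparatelyPolynomial.polynomial
      (G := fun (k : ((β ⊕ μ) ⊕ ξ) × Fin m) Y => MvPolynomial.eval (Y k.1) (lam k.2))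
      (fun k => IsSeparatelyPolynomial.eval (lam k.2) k.1) f
  have hp2 : IsSeparatelyPolynomial fun Y : (β ⊕ μ) ⊕ ξ → Fin n → ℂ =>
      (Matrix.of fun s t => MvPolynomial.eval (Y (Sum.inl (Sum.inl s))) (ℓ t)).det :=
    IsSeparatelyPolynomial.det fun s t => IsSeparatelyPolynomial.eval _ _
  have hp3 : IsSeparatelyPolynomial fun Y : (β ⊕ μ) ⊕ ξ → Fin n → ℂ =>
      (Matrix.of fun s t => MvPolynomial.eval (Y s) (g t)).det :=
    IsSeparatelyPolynomial.det fun s t => IsSeparatelyPolynomial.eval _ _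
  have hp4 : ∀ j, IsSeparatelyPolynomial fun Y : (β ⊕ μ) ⊕ ξ → Fin n → ℂ =>
      (Matrix.of fun s t => MvPolynomial.eval (Y (Sum.inl s)) (G j t)).det := fun j =>
    IsSeparatelyPolynomial.det fun s t => IsSeparatelyPolynomial.eval _ _
  have hn2 : ∃ Y : (β ⊕ μ) ⊕ ξ → Fin n → ℂ, (∀ l, Y l ∈ C) ∧
      (Matrix.of fun s t => MvPolynomial.eval (Y (Sum.inl (Sum.inl s))) (ℓ t)).det ≠ 0 := by
    obtain ⟨Z, hZ, hZ0⟩ := exists_det_ne_zero hℓx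
    refine ⟨Sum.elim (Sum.elim Z fun _ => y₀) fun _ => y₀, ?_, hZ0⟩
    rintro ((l | l) | l)
    · exact hZ l
    · exact hy₀
    · exact hy₀
  have hn4 : ∀ j ∈ J, ∃ Y : (β ⊕ μ) ⊕ ξ → Fin n → ℂ, (∀ l, Y l ∈ C) ∧
      (Matrix.of fun s t => MvPolynomial.eval (Y (Sum.inl s)) (G j t)).det ≠ 0 := by
    intro j hj
    obtain ⟨Z, hZ, hZ0⟩ := exists_det_ne_zero (hG j hj).2
    refine ⟨Sum.elim Z fun _ => y₀, ?_, hZ0⟩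
    rintro (l | l)
    · exact hZ l
    · exact hy₀
  obtain ⟨Y₄, hY₄, hne4⟩ := hC.exists_all_ne_zero J _ (fun j _ => hp4 j) hn4
  have hprod := IsSeparatelyPolynomial.prod J fun j _ => hp4 j
  obtain ⟨Y₁, hY₁, hne11, hne12⟩ := hC.exists_both_ne_zero hp1 hp2
    (IsIrreducibleCone.exists_eval_ne_zero hlam hC.nonempty hf) hn2
  obtain ⟨Y₂, hY₂, hne23, hne24⟩ := hC.exists_both_ne_zero hp3 hprod
    (exists_det_ne_zero hgx) ⟨Y₄, hY₄, Finset.prod_ne_zero_iff.mpr hne4⟩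
  obtain ⟨Y, hY, hne1, hne2⟩ := hC.exists_both_ne_zero (hp1.mul hp2) (hp3.mul hprod)
    ⟨Y₁, hY₁, mul_ne_zero hne11 hne12⟩ ⟨Y₂, hY₂, mul_ne_zero hne23 hne24⟩
  refine ⟨Y, hY, (mul_ne_zero_iff.mp hne1).1, ?_, ?_, ?_⟩
  · have h1 := (ImposeIndependentConditions.of_det (Y := fun s => Y (Sum.inl (Sum.inl s))) ℓ hℓ
      (mul_ne_zero_iff.mp hne1).2).linearIndependent
    have h2 : Submodule.span ℂ (Set.range fun s => Y (Sum.inl (Sum.inl s))) =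
        Submodule.span ℂ C := by
      apply Submodule.eq_of_le_of_finrank_eq
      · exact Submodule.span_mono (by rintro _ ⟨s, rfl⟩; exact hY _)
      · rw [finrank_span_eq_card h1, hβ]
    intro l
    have h3 : Y l ∈ Submodule.span ℂ (Set.range fun s => Y (Sum.inl (Sum.inl s))) := by
      rw [h2]; exact Submodule.subset_span (hY l)
    obtain ⟨c, hc⟩ := (Submodule.mem_span_range_iff_exists_fun ℂ).mp h3
    exact ⟨c, hc.symm⟩
  · intro j hj
    exact ImposeIndependentConditions.of_det (G j) (hG j hj).1
      (Finset.prod_ne_zero_iff.mp (mul_ne_zero_iff.mp hne2).2 j hj)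
  · exact ImposeIndependentConditions.of_det g hg (mul_ne_zero_iff.mp hne2).1

end Forms

end

/-! ### Ideals of cones, and elimination with multipliers -/

section

variable {n r : ℕ} {δ : Fin r → ℕ}

theorem mem_vanishingIdeal_iff_eval {σ : Type} {C : Set (σ → ℂ)} {g : MvPolynomial σ ℂ} :
    g ∈ MvPolynomial.vanishingIdeal ℂ C ↔ ∀ y ∈ C, MvPolynomial.eval y g = 0 := by
  rw [MvPolynomial.mem_vanishingIdeal_iff]
  simp [MvPolynomial.aeval_eq_eval]

theorem IsIrreducibleCone.isPrime_vanishingIdeal {C : Set (Fin n → ℂ)} (hC : IsIrreducibleCone C) :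
    (MvPolynomial.vanishingIdeal ℂ C).IsPrime := by
  constructor
  · intro htop
    obtain ⟨y, hy⟩ := hC.nonempty
    have := mem_vanishingIdeal_iff_eval.mp
      (show (1 : MvPolynomial (Fin n) ℂ) ∈ _ from htop ▸ Submodule.mem_top) y hy
    simp at this
  · intro f g hfg
    by_contra! hne
    rw [mem_vanishingIdeal_iff_eval, mem_vanishingIdeal_iff_eval] at hne
    push Not at hne
    obtain ⟨y, hy, h1, h2⟩ := hC.irreducible f g hne.1 hne.2
    have := mem_vanishingIdeal_iff_eval.mp hfg y hy
    rw [map_mul] at this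
    exact mul_ne_zero h1 h2 this

/-! ### Finiteness of the zeros of a tuple along given linear forms -/

/-- Multipliers by which the monomials of degree `degree` are to be expressed through the first
polynomials of a tuple and some linear forms. -/
structure Multipliers (δ : Fin r → ℕ) (n m : ℕ) (i : Fin r) where
  degree : ℕ
  degree_pos : 0 < degree
  form : {μ : Fin n →₀ ℕ // μ.degree = degree} → {j : Fin r // j < i} → MvPolynomial (Fin n) ℂ
  linear : {μ : Fin n →₀ ℕ // μ.degree = degree} → Fin m → MvPolynomial (Fin n) ℂ
  -- Prescribing the degree of the multiplier as `degree - δ j` would be wrong for `δ j > degree`,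
  -- where the subtraction truncates; the condition on products avoids this.
  form_mul : ∀ μ (j : {j : Fin r // j < i}) (q : MvPolynomial (Fin n) ℂ), q.IsHomogeneous (δ j.1) →
    (form μ j * q).IsHomogeneous degree
  linear_homogeneous : ∀ μ u, (linear μ u).IsHomogeneous (degree - 1)

theorem isHomogeneous_paramSpace (p : ParamSpace n δ) (j : Fin r) :
    (p j : MvPolynomial (Fin n) ℂ).IsHomogeneous (δ j) :=
  (MvPolynomial.mem_homogeneousSubmodule _ _).mp (p j).2

theorem eq_sum_monomials {n D : ℕ} {f : MvPolynomial (Fin n) ℂ} (hf : f.IsHomogeneous D) :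
    f = ∑ m : {m : Fin n →₀ ℕ // m.degree = D}, MvPolynomial.monomial m.1 (f.coeff m.1) := by
  classical
  ext κ
  rw [MvPolynomial.coeff_sum]
  by_cases h : κ.degree = D
  · rw [Finset.sum_eq_single ⟨κ, h⟩]
    · simp
    · intro ν _ hν
      rw [MvPolynomial.coeff_monomial, if_neg fun h => hν (Subtype.ext h)]
    · simp
  · rw [hf.coeff_eq_zero h]
    symm
    refine Finset.sum_eq_zero fun ν _ => ?_
    rw [MvPolynomial.coeff_monomial, if_neg]
    intro h'
    exact h (h' ▸ ν.2)

namespace Multipliers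

variable {m : ℕ} {i : Fin r} (c : Multipliers δ n m i) (lam : Fin m → MvPolynomial (Fin n) ℂ)

/-- The combination of the polynomials of a tuple and the linear forms given by multipliers. -/
def combination (p : ParamSpace n δ) (μ : {μ : Fin n →₀ ℕ // μ.degree = c.degree}) :
    MvPolynomial (Fin n) ℂ :=
  ∑ j, c.form μ j * (p j.1 : MvPolynomial (Fin n) ℂ) + ∑ u, c.linear μ u * lam u

/-- The matrix of the combinations, with entries polynomial in the tuple. -/
def matrix : Matrix {μ : Fin n →₀ ℕ // μ.degree = c.degree} {μ : Fin n →₀ ℕ // μ.degree = c.degree}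
    (MvPolynomial (CoeffIndex n δ) ℂ) := fun μ ν =>
  ∑ j : {j : Fin r // j < i}, ∑ κ : {κ : Fin n →₀ ℕ // κ.degree = δ j},
    MvPolynomial.C ((c.form μ j * MvPolynomial.monomial κ.1 1).coeff ν.1) *
      MvPolynomial.X (⟨j.1, κ⟩ : CoeffIndex n δ) +
  MvPolynomial.C ((∑ u, c.linear μ u * lam u).coeff ν.1)

theorem eval_matrix (p : ParamSpace n δ) (μ ν) :
    MvPolynomial.eval (coords p) (c.matrix lam μ ν) = (c.combination lam p μ).coeff ν.1 := by
  rw [matrix, combination, MvPolynomial.coeff_add, map_add, MvPolynomial.eval_C]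
  refine congrArg₂ (· + ·) ?_ rfl
  rw [map_sum, MvPolynomial.coeff_sum]
  refine Finset.sum_congr rfl fun j _ => ?_
  conv_rhs => rw [eq_sum_monomials (isHomogeneous_paramSpace p j.1), Finset.mul_sum,
    MvPolynomial.coeff_sum]
  rw [map_sum (MvPolynomial.eval (coords p))]
  refine Finset.sum_congr rfl fun κ _ => ?_
  rw [map_mul, MvPolynomial.eval_C, MvPolynomial.eval_X, coords]
  dsimp only
  have : (MvPolynomial.monomial κ.1 (MvPolynomial.coeff κ.1 (p j.1 : MvPolynomial (Fin n) ℂ)) :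
      MvPolynomial (Fin n) ℂ) = MvPolynomial.C (MvPolynomial.coeff κ.1
        (p j.1 : MvPolynomial (Fin n) ℂ)) * MvPolynomial.monomial κ.1 1 := by
    rw [MvPolynomial.C_mul_monomial, mul_one]
  rw [this, mul_left_comm, MvPolynomial.coeff_C_mul, mul_comm]

theorem combination_isHomogeneous (hlam : ∀ u, (lam u).IsHomogeneous 1) (p : ParamSpace n δ) (μ) :
    (c.combination lam p μ).IsHomogeneous c.degree := by
  unfold combination
  refine MvPolynomial.IsHomogeneous.add ?_ ?_
  · exact MvPolynomial.IsHomogeneous.sum _ _ _ fun j _ =>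
      c.form_mul μ j _ (isHomogeneous_paramSpace p j.1)
  · refine MvPolynomial.IsHomogeneous.sum _ _ _ fun u _ => ?_
    have := (c.linear_homogeneous μ u).mul (hlam u)
    rwa [Nat.sub_add_cancel c.degree_pos] at this

/-- At a common zero of the first polynomials only the linear forms contribute, with cofactors of
degree `degree - 1`. These are the relations required by `isAlgebraic_of_monomial_relations`. The
ring `A` is arbitrary because both the function field of a cone and `ℂ` itself occur. -/
theorem sum_matrix (hlam : ∀ u, (lam u).IsHomogeneous 1) (p : ParamSpace n δ) (μ)
    {A : Type*} [CommRing A] [Algebra ℂ A] (y : Fin n → A)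
    (hy : ∀ j < i, MvPolynomial.aeval y (p j : MvPolynomial (Fin n) ℂ) = 0) :
    ∑ ν, algebraMap ℂ A (MvPolynomial.eval (coords p) (c.matrix lam μ ν)) *
      ∏ t, y t ^ ν.1 t =
    ∑ u, MvPolynomial.aeval y (c.linear μ u) * MvPolynomial.aeval y (lam u) := by
  have h1 := aeval_eq_sum_monomials (c.combination_isHomogeneous lam hlam p μ) y
  simp only [c.eval_matrix]
  rw [← h1, combination, map_add, map_sum, map_sum]
  simp only [map_mul]
  rw [Finset.sum_eq_zero fun j _ => by rw [hy j.1 j.2, mul_zero], zero_add]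

theorem aeval_mul_mem_span {F Ω : Type} [Field F] [Field Ω] [Algebra ℂ Ω] [Algebra ℂ F]
    [Algebra F Ω] [IsScalarTower ℂ F Ω] {D : ℕ} {f : MvPolynomial (Fin n) ℂ}
    (hD : 0 < D) (hf : f.IsHomogeneous (D - 1)) (y : Fin n → Ω) (z : F) :
    MvPolynomial.aeval y f * algebraMap F Ω z ∈
      Submodule.span F {x | ∃ κ : Fin n →₀ ℕ, κ.degree < D ∧ x = ∏ t, y t ^ κ t} := by
  rw [aeval_eq_sum_monomials hf, Finset.sum_mul]
  refine Submodule.sum_mem _ fun κ _ => ?_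
  have : (algebraMap ℂ Ω (f.coeff κ.1) * ∏ t, y t ^ κ.1 t) * algebraMap F Ω z =
      (z * algebraMap ℂ F (f.coeff κ.1)) • ∏ t, y t ^ κ.1 t := by
    rw [Algebra.smul_def, map_mul, ← IsScalarTower.algebraMap_apply]
    ring
  rw [this]
  exact Submodule.smul_mem _ _ (Submodule.subset_span ⟨κ.1, by have := κ.2; omega, rfl⟩)

/-- On an irreducible cone of codimension at most `n - m` on which the first polynomials vanish, the
linear forms are algebraically independent. -/
theorem exists_eval_ne_zero (hlam : ∀ u, (lam u).IsHomogeneous 1) {C : Set (Fin n → ℂ)}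
    (hC : IsIrreducibleCone C) {h : ℕ} (hh : (MvPolynomial.vanishingIdeal ℂ C).height ≤ h)
    (hn : h + m ≤ n) (p : ParamSpace n δ)
    (hp : ∀ j < i, ∀ y ∈ C, MvPolynomial.eval y (p j : MvPolynomial (Fin n) ℂ) = 0)
    (hdet : MvPolynomial.eval (coords p) (c.matrix lam).det ≠ 0)
    (f : MvPolynomial (Fin m) ℂ) (hf : f ≠ 0) :
    ∃ y ∈ C, MvPolynomial.eval (fun u => MvPolynomial.eval y (lam u)) f ≠ 0 := by
  set Q := MvPolynomial.vanishingIdeal ℂ C with hQ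
  have hmem : ∀ g, g ∈ Q ↔ ∀ y ∈ C, MvPolynomial.eval y g = 0 := fun g =>
    mem_vanishingIdeal_iff_eval
  have hprime : Q.IsPrime := hC.isPrime_vanishingIdeal
  let A := MvPolynomial (Fin n) ℂ ⧸ Q
  let L := FractionRing A
  let ψ : MvPolynomial (Fin n) ℂ →ₐ[ℂ] L :=
    (IsScalarTower.toAlgHom ℂ A L).comp (Ideal.Quotient.mkₐ ℂ Q)
  have hψ : ∀ g, ψ g = 0 ↔ g ∈ Q := fun g => by
    rw [← Ideal.Quotient.eq_zero_iff_mem]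
    exact map_eq_zero_iff _ (IsFractionRing.injective A L)
  let y : Fin n → L := fun t => ψ (MvPolynomial.X t)
  have hy : ∀ g, MvPolynomial.aeval y g = ψ g := fun g => by
    have : MvPolynomial.aeval y = ψ := by ext t; simp [y]
    rw [this]
  let w : Fin m → L := fun u => ψ (lam u)
  let F := algClosureOf ℂ (Set.range w)
  have hw : ∀ u, w u ∈ F := fun u => subset_algClosureOf _ ⟨u, rfl⟩
  have hyF : ∀ t, y t ∈ F := by
    intro t
    apply mem_algClosureOf_of_isAlgebraic
    refine isAlgebraic_of_monomial_relations y
      ((c.matrix lam).map fun x => algebraMap ℂ F (MvPolynomial.eval (coords p) x)) ?_ ?_ t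
    · have : ((c.matrix lam).map fun x => algebraMap ℂ F (MvPolynomial.eval (coords p) x)).det =
          ((algebraMap ℂ F).comp (MvPolynomial.eval (coords p))) (c.matrix lam).det :=
        (RingHom.map_det ((algebraMap ℂ F).comp (MvPolynomial.eval (coords p)))
          (c.matrix lam)).symm
      rw [this, RingHom.comp_apply]
      simpa using hdet
    · intro μ
      have h1 := c.sum_matrix lam hlam p μ y (fun j hj => by
        rw [hy, hψ, hmem]; exact hp j hj)
      simp only [Matrix.map_apply, ← IsScalarTower.algebraMap_apply]
      rw [h1]
      refine Submodule.sum_mem _ fun u _ => ?_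
      rw [hy (lam u)]
      exact aeval_mul_mem_span c.degree_pos (c.linear_homogeneous μ u) y (⟨w u, hw u⟩ : F)
  -- The function field of `C` contains at least `n - h ≥ m` independent coordinates, all algebraic
  -- over the `m` elements `w u`; hence these are independent.
  obtain ⟨κ, hκ, v, hv, hcard⟩ := exists_independent_variables (k := ℂ) (Fin n) Q
  have hvi : AlgebraicIndependent ℂ fun k => y (v k) := by
    rw [algebraicIndependent_iff]
    intro g hg
    apply hv
    rw [← hψ, ← hy, MvPolynomial.aeval_rename]
    exact hg
  have hmκ : Nat.card (Fin m) ≤ Nat.card κ := by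
    have h1 : (n : ℕ∞) ≤ h + Nat.card κ := by
      have := hcard
      rw [Nat.card_eq_fintype_card, Fintype.card_fin] at this
      exact this.trans (by gcongr)
    have h2 : n ≤ h + Nat.card κ := by exact_mod_cast h1
    rw [Nat.card_eq_fintype_card, Fintype.card_fin]
    omega
  have hwi := algebraicIndependent_of_card_le hvi (w := w) (fun k => hyF _) hmκ
  by_contra! hall
  apply hf
  refine (algebraicIndependent_iff.mp hwi) f ?_
  have h1 : MvPolynomial.aeval w f = ψ (MvPolynomial.bind₁ lam f) := by
    change _ = (ψ.comp (MvPolynomial.bind₁ lam)) f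
    congr 1
    ext u
    simp [w]
  rw [h1, hψ, hmem]
  intro z hz
  rw [← hall z hz]
  simp only [MvPolynomial.eval, MvPolynomial.eval₂Hom_bind₁]

end Multipliers

end

section

/-! ### The dimension count -/

theorem algHom_eval {W κ Ω : Type} [Field Ω] [Algebra ℂ Ω] (φ : (W → ℂ) →ₐ[ℂ] Ω) (g : κ → W → ℂ)
    (f : MvPolynomial κ ℂ) :
    φ (fun w => MvPolynomial.eval (fun k => g k w) f) = MvPolynomial.aeval (fun k => φ (g k)) f := by
  have h1 : (fun w => MvPolynomial.eval (fun k => g k w) f) = MvPolynomial.aeval (R := ℂ) g f := by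
    induction f using MvPolynomial.induction_on with
    | C a => funext w; simp
    | add p q hp hq => funext w; simp [← hp, ← hq]
    | mul_X p k hp => funext w; simp [← hp]
  rw [h1]
  exact congrArg (fun F => F f) (MvPolynomial.comp_aeval g φ)

theorem aeval_mem_intermediateField {κ Ω : Type} [Field Ω] [Algebra ℂ Ω] (E : IntermediateField ℂ Ω)
    {g : κ → Ω} (f : MvPolynomial κ ℂ) (hg : ∀ k ∈ f.vars, g k ∈ E) :
    MvPolynomial.aeval g f ∈ E := by
  rw [MvPolynomial.aeval_def, MvPolynomial.eval₂_eq]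
  refine sum_mem fun d hd => mul_mem (E.algebraMap_mem _) (prod_mem fun k hk => pow_mem (hg k ?_) _)
  rw [MvPolynomial.mem_vars_iff_mem_support]
  exact ⟨d, hd, hk⟩

theorem eval_sumAlgEquiv {ζ κ : Type} (f : MvPolynomial (ζ ⊕ κ) ℂ) (z : ζ → ℂ) (x : κ → ℂ) :
    MvPolynomial.eval z (MvPolynomial.map (MvPolynomial.eval x) (MvPolynomial.sumAlgEquiv ℂ ζ κ f)) =
      MvPolynomial.eval (Sum.elim z x) f := by
  induction f using MvPolynomial.induction_on with
  | C a => simp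
  | add p q hp hq => simp [hp, hq]
  | mul_X p k hp => rcases k with k | k <;> simp [hp]

/-- Some coefficient of `f`, viewed as a polynomial in the `ζ`-variables, is a nonzero polynomial in
the variables `v k`. It is not in `P`, so it cannot vanish on all of `S`. -/
theorem exists_eval_ne_zero_of_family {σ κ ζ : Type} {S : Set (σ → ℂ)}
    {P : Ideal (MvPolynomial σ ℂ)}
    (hS : MvPolynomial.vanishingIdeal ℂ S ≤ P) {v : κ → σ}
    (hv : ∀ f : MvPolynomial κ ℂ, MvPolynomial.rename v f ∈ P → f = 0)
    {f : MvPolynomial (ζ ⊕ κ) ℂ} (hf : f ≠ 0) :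
    ∃ x ∈ S, MvPolynomial.map (MvPolynomial.eval fun k => x (v k))
      (MvPolynomial.sumAlgEquiv ℂ ζ κ f) ≠ 0 := by
  have hf' : MvPolynomial.sumAlgEquiv ℂ ζ κ f ≠ 0 := by simpa using hf
  obtain ⟨α, hα⟩ := MvPolynomial.ne_zero_iff.mp hf'
  have h1 : MvPolynomial.rename v ((MvPolynomial.sumAlgEquiv ℂ ζ κ f).coeff α) ∉
      MvPolynomial.vanishingIdeal ℂ S := fun h => hα (hv _ (hS h))
  rw [MvPolynomial.mem_vanishingIdeal_iff] at h1
  push Not at h1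
  obtain ⟨x, hx, hx0⟩ := h1
  refine ⟨x, hx, fun h0 => hx0 ?_⟩
  have := congrArg (MvPolynomial.coeff α) h0
  rw [MvPolynomial.coeff_map, MvPolynomial.coeff_zero] at this
  rw [MvPolynomial.aeval_rename, MvPolynomial.aeval_eq_eval]
  exact this

/-- The `γ m` are the coefficients of forms dual to the points `η l`, so pairing a linear relation
with `γ m` isolates its `m`-th coefficient. -/
theorem linearIndependent_monomials {ι Ω : Type} [Fintype ι] [DecidableEq ι] [Field Ω]
    [Algebra ℂ Ω] {n D : ℕ} (η : ι → Fin n → Ω) (γ : ι → {m : Fin n →₀ ℕ // m.degree = D} → Ω)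
    (h : ∀ l m, ∑ ν, γ m ν * ∏ t, η l t ^ ν.1 t = if l = m then 1 else 0) :
    LinearIndependent Ω fun l (ν : {m : Fin n →₀ ℕ // m.degree = D}) => ∏ t, η l t ^ ν.1 t := by
  rw [Fintype.linearIndependent_iff]
  intro x hx m
  have h1 : ∑ ν, γ m ν * (∑ l, x l • fun (ν : {m : Fin n →₀ ℕ // m.degree = D}) =>
      ∏ t, η l t ^ ν.1 t) ν = 0 := by rw [hx]; simp
  simp only [Finset.sum_apply, Pi.smul_apply, smul_eq_mul, Finset.mul_sum] at h1
  rw [Finset.sum_comm] at h1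
  have h2 : ∀ l, ∑ ν, γ m ν * (x l * ∏ t, η l t ^ ν.1 t) = x l * if l = m then 1 else 0 := by
    intro l
    rw [← h, Finset.mul_sum]
    exact Finset.sum_congr rfl fun ν _ => by ring
  simpa [h2] using h1

theorem encard_range_le {α β : Type} [Fintype α] (f : α → β) :
    (Set.range f).encard ≤ Fintype.card α := by
  rw [← Set.image_univ]
  refine (Set.encard_image_le _ _).trans ?_
  simp

theorem encard_iUnion_le {α ι : Type} [Fintype ι] (s : ι → Set α) :
    (⋃ i, s i).encard ≤ ∑ i, (s i).encard := by
  classical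
  have : ∀ t : Finset ι, (⋃ i ∈ t, s i).encard ≤ ∑ i ∈ t, (s i).encard := by
    intro t
    induction t using Finset.induction_on with
    | empty => simp
    | insert a t ha ih =>
      rw [Finset.set_biUnion_insert, Finset.sum_insert ha]
      exact (Set.encard_union_le _ _).trans (by gcongr)
  simpa using this Finset.univ

variable {n r : ℕ} {δ : Fin r → ℕ}

/-- The tuple `p` vanishes at general points `Y` of a cone: the points `Y t`, `t ∈ β`, span, and the
points impose enough independent conditions. -/
structure IsGeneralZero {β μ ξ : Type} [Fintype β] [DecidableEq β] [DecidableEq μ] [DecidableEq ξ]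
    (i : Fin r) (p : ParamSpace n δ) (Y : (β ⊕ μ) ⊕ ξ → Fin n → ℂ) : Prop where
  vanish : ∀ l, ∀ j ≤ i, MvPolynomial.eval (Y l) (p j : MvPolynomial (Fin n) ℂ) = 0
  span : ∀ l, ∃ c : β → ℂ, Y l = ∑ t, c t • Y (Sum.inl (Sum.inl t))
  independent_before : ∀ j < i, ImposeIndependentConditions (δ j) fun l => Y (Sum.inl l)
  independent : ImposeIndependentConditions (δ i) Y

/-- If the tuples of a dense subset of a subvariety have general zeros, where the values of `n - i`
linear forms are arbitrary, then the codimension of the subvariety is large. -/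
theorem add_card_le_height {β μ ξ : Type} [Fintype β] [Fintype μ] [Fintype ξ] [DecidableEq β]
    [DecidableEq μ] [DecidableEq ξ] {m : ℕ} {i : Fin r} (c : Multipliers δ n m i)
    {lam : Fin m → MvPolynomial (Fin n) ℂ} (hlam : ∀ u, (lam u).IsHomogeneous 1)
    (hn : n = i + m) (P : Ideal (MvPolynomial (CoeffIndex n δ) ℂ)) [P.IsPrime]
    (S : Set (ParamSpace n δ)) (hSP : MvPolynomial.vanishingIdeal ℂ (coords '' S) ≤ P)
    (hdet : ∀ p ∈ S, MvPolynomial.eval (coords p) (c.matrix lam).det ≠ 0)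
    (hgen : ∀ p ∈ S, ∀ f : MvPolynomial (((β ⊕ μ) ⊕ ξ) × Fin m) ℂ, f ≠ 0 →
      ∃ Y : (β ⊕ μ) ⊕ ξ → Fin n → ℂ, IsGeneralZero i p Y ∧
        MvPolynomial.eval (fun k => MvPolynomial.eval (Y k.1) (lam k.2)) f ≠ 0) :
    ((Fintype.card μ * n + (Fintype.card β + Fintype.card μ + Fintype.card ξ) : ℕ) : ℕ∞) ≤
      P.height + (Fintype.card β * Fintype.card μ : ℕ) := by
  classical
  obtain ⟨κ, hκ, v, hv, hcard⟩ := exists_independent_variables (k := ℂ) (CoeffIndex n δ) P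
  let ι := (β ⊕ μ) ⊕ ξ
  -- `W` is used only as a set. The functions `U` on it, namely the values of the linear forms at
  -- all points and the tuple coordinates free modulo `P`, satisfy no polynomial relation.
  let W := {w : ParamSpace n δ × (ι → Fin n → ℂ) // w.1 ∈ S ∧ IsGeneralZero i w.1 w.2}
  let U : (ι × Fin m) ⊕ κ → W → ℂ := Sum.elim
    (fun k w => MvPolynomial.eval (w.1.2 k.1) (lam k.2)) fun k w => coords w.1.1 (v k)
  obtain ⟨Ω, _, _, φ, hφ⟩ := exists_generic_point U (by
    intro f hf
    obtain ⟨_, ⟨p, hp, rfl⟩, hp0⟩ := exists_eval_ne_zero_of_family hSP hv hf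
    obtain ⟨Y, hY, hY0⟩ := hgen p hp _ hp0
    refine ⟨⟨(p, Y), hp, hY⟩, ?_⟩
    rw [eval_sumAlgEquiv] at hY0
    convert hY0 using 2
    congr 1
    funext k
    rcases k with k | k <;> rfl)
  have hφconst : ∀ a : ℂ, φ (fun _ => a) = algebraMap ℂ Ω a := fun a => φ.commutes a
  -- The generic tuple `π`, the generic points `η`, and the values `ζ` of the linear forms at them.
  let π : CoeffIndex n δ → Ω := fun a => φ fun w => coords w.1.1 a
  let η : ι → Fin n → Ω := fun l t => φ fun w => w.1.2 l t
  let ζ : ι → Fin m → Ω := fun l u => φ fun w => MvPolynomial.eval (w.1.2 l) (lam u)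
  have hζ : ∀ l u, ζ l u = MvPolynomial.aeval (η l) (lam u) := fun l u =>
    algHom_eval φ (fun t (w : W) => w.1.2 l t) (lam u)
  -- values of homogeneous forms whose coefficients vary
  have hform : ∀ {D : ℕ} (F : W → MvPolynomial (Fin n) ℂ) (_ : ∀ w, (F w).IsHomogeneous D) (l : ι),
      φ (fun w => MvPolynomial.eval (w.1.2 l) (F w)) =
        ∑ ν : {m : Fin n →₀ ℕ // m.degree = D}, φ (fun w => (F w).coeff ν.1) *
          ∏ t, η l t ^ ν.1 t := by
    intro D F hF l
    have h1 : (fun w => MvPolynomial.eval (w.1.2 l) (F w)) =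
        ∑ ν : {m : Fin n →₀ ℕ // m.degree = D}, (fun w => (F w).coeff ν.1) *
          ∏ t, (fun w : W => w.1.2 l t) ^ ν.1 t := by
      funext w
      rw [eval_eq_sum_monomials (hF w)]
      simp
    rw [h1, map_sum]
    refine Finset.sum_congr rfl fun ν _ => ?_
    rw [map_mul, map_prod]
    simp only [map_pow]
    rfl
  have hvanish : ∀ l, ∀ j ≤ i, ∑ ν : {m : Fin n →₀ ℕ // m.degree = δ j},
      (∏ t, η l t ^ ν.1 t) * π ⟨j, ν⟩ = 0 := by
    intro l j hj
    have h1 := hform (fun w => (w.1.1 j : MvPolynomial (Fin n) ℂ))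
      (fun w => isHomogeneous_paramSpace w.1.1 j) l
    have h2 : (fun w : W => MvPolynomial.eval (w.1.2 l) (w.1.1 j : MvPolynomial (Fin n) ℂ)) = 0 := by
      funext w
      exact w.2.2.vanish l j hj
    rw [h2, map_zero] at h1
    rw [h1]
    exact Finset.sum_congr rfl fun ν _ => mul_comm _ _
  have hindep_before : ∀ j < i, LinearIndependent Ω
      fun (l : β ⊕ μ) (ν : {m : Fin n →₀ ℕ // m.degree = δ j}) => ∏ t, η (Sum.inl l) t ^ ν.1 t := by
    intro j hj
    -- Dual forms are chosen separately for each `w`. Since `φ` is defined on arbitrary functions,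
    -- they need not depend algebraically on `w`.
    choose γ hγ hd using fun w : W => w.2.2.independent_before j hj
    refine linearIndependent_monomials (fun l => η (Sum.inl l))
      (fun m ν => φ fun w => (γ w m).coeff ν.1) fun l m => ?_
    rw [← hform (fun w => γ w m) (fun w => hγ w m) (Sum.inl l)]
    simp only [hd]
    rw [hφconst]
    split_ifs <;> simp
  have hindep : LinearIndependent Ω
      fun (l : ι) (ν : {m : Fin n →₀ ℕ // m.degree = δ i}) => ∏ t, η l t ^ ν.1 t := by
    choose γ hγ hd using fun w : W => w.2.2.independent
    refine linearIndependent_monomials η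
      (fun m ν => φ fun w => (γ w m).coeff ν.1) fun l m => ?_
    rw [← hform (fun w => γ w m) (fun w => hγ w m) l]
    simp only [hd]
    rw [hφconst]
    split_ifs <;> simp
  choose b hb using fun (l : ι) (w : W) => w.2.2.span l
  -- Each point indexed by `μ` costs `card β` coefficients rather than `n` coordinates; this
  -- produces the gain `q (n - E)`.
  let X₁ : Set Ω := (Set.range fun k : β × Fin n => η (Sum.inl (Sum.inl k.1)) k.2) ∪
    Set.range fun k : μ × β => φ fun w => b (Sum.inl (Sum.inr k.1)) w k.2
  let E₁ := algClosureOf ℂ X₁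
  have hη₁ : ∀ (l : β ⊕ μ) t, η (Sum.inl l) t ∈ E₁ := by
    rintro (l | l) t
    · exact subset_algClosureOf _ (Or.inl ⟨(l, t), rfl⟩)
    · have h1 : (fun w : W => w.1.2 (Sum.inl (Sum.inr l)) t) =
          ∑ s, (fun w => b (Sum.inl (Sum.inr l)) w s) * fun w => w.1.2 (Sum.inl (Sum.inl s)) t := by
        funext w
        conv_lhs => rw [hb (Sum.inl (Sum.inr l)) w]
        simp
      have h2 : η (Sum.inl (Sum.inr l)) t = ∑ s, φ (fun w => b (Sum.inl (Sum.inr l)) w s) *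
          η (Sum.inl (Sum.inl s)) t := by
        change φ _ = _
        rw [h1, map_sum]
        exact Finset.sum_congr rfl fun s _ => map_mul _ _ _
      rw [h2]
      exact sum_mem fun s _ => mul_mem (subset_algClosureOf _ (Or.inr ⟨(l, s), rfl⟩))
        (subset_algClosureOf _ (Or.inl ⟨(s, t), rfl⟩))
  have hG : ∀ j : {j : Fin r // j < i}, ∃ G : Set Ω,
      G.encard + Fintype.card (β ⊕ μ) ≤ Fintype.card {m : Fin n →₀ ℕ // m.degree = δ j.1} ∧
      ∀ F : IntermediateField ℂ Ω, E₁ ≤ F → G ⊆ F → ∀ ν, π ⟨j.1, ν⟩ ∈ F := fun j =>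
    exists_free_coordinates E₁ _ (fun l ν => prod_mem fun t _ => pow_mem (hη₁ l t) _)
      (hindep_before j.1 j.2) (fun ν => π ⟨j.1, ν⟩) fun l => hvanish _ _ j.2.le
  choose G hGcard hGmem using hG
  let X₂ : Set Ω := (X₁ ∪ Set.range fun k : ξ × Fin m => ζ (Sum.inr k.1) k.2) ∪ ⋃ j, G j
  let E₂ := algClosureOf ℂ X₂
  have hE₁₂ : E₁ ≤ E₂ := algClosureOf_mono fun x hx => Or.inl (Or.inl hx)
  have hπ₂ : ∀ j < i, ∀ ν, π ⟨j, ν⟩ ∈ E₂ := fun j hj =>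
    hGmem ⟨j, hj⟩ E₂ hE₁₂ ((Set.subset_iUnion G ⟨j, hj⟩).trans
      (Set.subset_union_right.trans (subset_algClosureOf _)))
  have hζ₂ : ∀ l u, ζ l u ∈ E₂ := by
    rintro (l | l) u
    · rw [hζ]
      exact aeval_mem_intermediateField E₂ _ fun t _ => hE₁₂ (hη₁ l t)
    · exact subset_algClosureOf _ (Or.inl (Or.inr ⟨(l, u), rfl⟩))
  have hmatrix : ∀ F : MvPolynomial (CoeffIndex n δ) ℂ,
      φ (fun w => MvPolynomial.eval (coords w.1.1) F) = MvPolynomial.aeval π F := fun F =>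
    algHom_eval φ (fun a (w : W) => coords w.1.1 a) F
  -- The points indexed by `ξ` are algebraic over the earlier polynomials and the values of the
  -- linear forms: the determinant of the multiplier matrix is nonzero at every `w`, so its image
  -- under `φ` is nonzero too.
  have hη₂ : ∀ l t, η l t ∈ E₂ := by
    intro l t
    have hmem : ∀ μ ν, MvPolynomial.aeval π (c.matrix lam μ ν) ∈ E₂ := by
      intro μ ν
      rw [Multipliers.matrix, map_add, map_sum]
      refine add_mem (sum_mem fun j _ => ?_) ?_
      · rw [map_sum]
        refine sum_mem fun κ _ => ?_
        rw [map_mul, MvPolynomial.aeval_X, MvPolynomial.aeval_C]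
        exact mul_mem (E₂.algebraMap_mem _) (hπ₂ _ j.2 _)
      · rw [MvPolynomial.aeval_C]
        exact E₂.algebraMap_mem _
    apply mem_algClosureOf_of_isAlgebraic
    let ε : Matrix {μ : Fin n →₀ ℕ // μ.degree = c.degree} {μ : Fin n →₀ ℕ // μ.degree = c.degree}
      E₂ := fun μ ν => ⟨_, hmem μ ν⟩
    refine isAlgebraic_of_monomial_relations (η l) ε ?_ ?_ t
    · intro h0
      have h1 := congrArg (algebraMap E₂ Ω) h0
      rw [RingHom.map_det, map_zero] at h1
      have h2 : (algebraMap E₂ Ω).mapMatrix ε =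
          (MvPolynomial.aeval π : _ →ₐ[ℂ] Ω).toRingHom.mapMatrix (c.matrix lam) := by
        ext μ ν; rfl
      rw [h2, ← RingHom.map_det] at h1
      have h3 : φ (fun w => MvPolynomial.eval (coords w.1.1) (c.matrix lam).det) = 0 := by
        rw [hmatrix]; exact h1
      have h4 : IsUnit (fun w : W => MvPolynomial.eval (coords w.1.1) (c.matrix lam).det) := by
        rw [Pi.isUnit_iff]
        exact fun w => (hdet _ w.2.1).isUnit
      exact (h4.map φ).ne_zero h3
    · intro μ
      have h1 : (fun w : W => ∑ ν, MvPolynomial.eval (coords w.1.1) (c.matrix lam μ ν) *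
          ∏ t, w.1.2 l t ^ ν.1 t) =
          fun w => ∑ u, MvPolynomial.eval (w.1.2 l) (c.linear μ u) *
            MvPolynomial.eval (w.1.2 l) (lam u) := by
        funext w
        have := c.sum_matrix lam hlam w.1.1 μ (w.1.2 l) (fun j hj => by
          rw [MvPolynomial.aeval_eq_eval]; exact w.2.2.vanish l j hj.le)
        simpa [MvPolynomial.aeval_eq_eval] using this
      have h2 : φ (fun w : W => ∑ ν, MvPolynomial.eval (coords w.1.1) (c.matrix lam μ ν) *
          ∏ t, w.1.2 l t ^ ν.1 t) = ∑ ν, algebraMap E₂ Ω (ε μ ν) * ∏ t, η l t ^ ν.1 t := by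
        have : (fun w : W => ∑ ν, MvPolynomial.eval (coords w.1.1) (c.matrix lam μ ν) *
            ∏ t, w.1.2 l t ^ ν.1 t) =
            ∑ ν, (fun w : W => MvPolynomial.eval (coords w.1.1) (c.matrix lam μ ν)) *
              ∏ t, (fun w : W => w.1.2 l t) ^ ν.1 t := by
          funext w; simp
        rw [this, map_sum]
        refine Finset.sum_congr rfl fun ν _ => ?_
        rw [map_mul, hmatrix, map_prod]
        simp only [map_pow]
        rfl
      have h3 : φ (fun w : W => ∑ u, MvPolynomial.eval (w.1.2 l) (c.linear μ u) *
            MvPolynomial.eval (w.1.2 l) (lam u)) =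
          ∑ u, MvPolynomial.aeval (η l) (c.linear μ u) * ζ l u := by
        have : (fun w : W => ∑ u, MvPolynomial.eval (w.1.2 l) (c.linear μ u) *
            MvPolynomial.eval (w.1.2 l) (lam u)) =
            ∑ u, (fun w : W => MvPolynomial.eval (w.1.2 l) (c.linear μ u)) *
            fun w => MvPolynomial.eval (w.1.2 l) (lam u) := by
          funext w; simp
        rw [this, map_sum]
        refine Finset.sum_congr rfl fun u _ => ?_
        rw [map_mul]
        exact congrArg (· * ζ l u) (algHom_eval φ (fun t (w : W) => w.1.2 l t) (c.linear μ u))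
      rw [← h2, h1, h3]
      exact Submodule.sum_mem _ fun u _ => Multipliers.aeval_mul_mem_span c.degree_pos
        (c.linear_homogeneous μ u) (η l) (⟨ζ l u, hζ₂ l u⟩ : E₂)
  obtain ⟨Gi, hGicard, hGimem⟩ := exists_free_coordinates E₂ _
    (fun l ν => prod_mem fun t _ => pow_mem (hη₂ l t) _) hindep (fun ν => π ⟨i, ν⟩)
    fun l => hvanish l i le_rfl
  -- Polynomials after `p i` satisfy no conditions, so all their coefficients are kept as
  -- generators.
  let H : Fin r → Set Ω := fun j => if h : j < i then G ⟨j, h⟩ else if j = i then Gi else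
    Set.range fun ν : {m : Fin n →₀ ℕ // m.degree = δ j} => π ⟨j, ν⟩
  let s : Fin r → ℕ := fun j => if j < i then Fintype.card (β ⊕ μ) else
    if j = i then Fintype.card ι else 0
  have hH : ∀ j, (H j).encard + s j ≤ Fintype.card {m : Fin n →₀ ℕ // m.degree = δ j} := by
    intro j
    simp only [H, s]
    split_ifs with h1 h2
    · exact hGcard ⟨j, h1⟩
    · subst h2; exact hGicard
    · simpa using encard_range_le _
  let X₃ : Set Ω := (X₁ ∪ Set.range fun k : ξ × Fin m => ζ (Sum.inr k.1) k.2) ∪ ⋃ j, H j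
  let E₃ := algClosureOf ℂ X₃
  have hE₂₃ : E₂ ≤ E₃ := by
    refine algClosureOf_mono (Set.union_subset_union_right _ ?_)
    refine Set.iUnion_subset fun j => ?_
    have : H j.1 = G j := by simp only [H]; rw [dif_pos j.2]
    rw [← this]
    exact Set.subset_iUnion H j.1
  have hHE : ∀ j, H j ⊆ E₃ := fun j => (Set.subset_iUnion H j).trans
    (Set.subset_union_right.trans (subset_algClosureOf _))
  have hπ₃ : ∀ a, π a ∈ E₃ := by
    rintro ⟨j, ν⟩
    rcases lt_trichotomy j i with h | h | h
    · exact hE₂₃ (hπ₂ j h ν)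
    · subst h
      refine hGimem E₃ hE₂₃ ?_ ν
      have : H j = Gi := by simp [H]
      rw [← this]
      exact hHE j
    · apply hHE j
      simp only [H]
      rw [dif_neg h.not_gt, if_neg h.ne']
      exact ⟨ν, rfl⟩
  have hU : ∀ k, φ (U k) ∈ E₃ := by
    rintro (k | k)
    · exact hE₂₃ (hζ₂ k.1 k.2)
    · exact hπ₃ (v k)
  have hfinal := card_le_of_algebraicIndependent hφ hU
  have hX₁ : X₁.encard ≤ (Fintype.card β * n + Fintype.card μ * Fintype.card β : ℕ) := by
    refine (Set.encard_union_le _ _).trans ?_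
    push_cast
    refine add_le_add ?_ ?_
    · refine (encard_range_le _).trans (le_of_eq ?_); simp
    · refine (encard_range_le _).trans (le_of_eq ?_); simp
  have hfin : ∀ j, ∃ a : ℕ, (H j).encard = a := fun j => by
    have : (H j).encard ≠ ⊤ := ne_top_of_le_ne_top (ENat.natCast_ne_top _)
      (le_self_add.trans (hH j))
    exact ⟨_, (ENat.natCast_toNat this).symm⟩
  choose a ha using hfin
  have hX₃ : X₃.encard ≤ ((Fintype.card β * n + Fintype.card μ * Fintype.card β) +
      Fintype.card ξ * m + ∑ j, a j : ℕ) := by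
    refine (Set.encard_union_le _ _).trans ?_
    push_cast
    refine add_le_add ((Set.encard_union_le _ _).trans (add_le_add ?_ ?_)) ?_
    · exact_mod_cast hX₁
    · refine (encard_range_le _).trans (le_of_eq ?_); simp
    · refine (encard_iUnion_le _).trans (le_of_eq ?_)
      exact Finset.sum_congr rfl fun j _ => ha j
  have hsum : ∑ j, a j + ∑ j, s j ≤ Nat.card (CoeffIndex n δ) := by
    have h1 : Nat.card (CoeffIndex n δ) =
        ∑ j, Fintype.card {m : Fin n →₀ ℕ // m.degree = δ j} := by
      rw [Nat.card_eq_fintype_card, Fintype.card_sigma]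
    rw [h1, ← Finset.sum_add_distrib]
    refine Finset.sum_le_sum fun j _ => ?_
    have := hH j
    rw [ha] at this
    exact_mod_cast this
  have hs : ∑ j, s j = i * Fintype.card (β ⊕ μ) + Fintype.card ι := by
    have h1 : ∀ j, s j = (if j < i then Fintype.card (β ⊕ μ) else 0) +
        if j = i then Fintype.card ι else 0 := by
      intro j
      simp only [s]
      split_ifs with h1 h2 h2
      · exact absurd h2 h1.ne
      · simp
      · simp
      · simp
    simp only [h1, Finset.sum_add_distrib, Finset.sum_ite_eq', Finset.mem_univ, if_true]
    congr 1
    rw [← Finset.sum_filter, Finset.sum_const, smul_eq_mul]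
    congr 1
    rw [Finset.filter_gt_eq_Iio, Fin.card_Iio]
  have hκU : Nat.card ((ι × Fin m) ⊕ κ) = Fintype.card ι * m + Nat.card κ := by
    rw [Nat.card_sum, Nat.card_prod]; simp
  rw [hκU] at hfinal
  -- Independent elements on the left, generators on the right. The terms `card ξ * m` cancel, and
  -- `n = i + m` combines the conditions on the earlier polynomials with the free values at the
  -- points into `(card β + card μ) * n`.
  have hmain : Fintype.card ι * m + Nat.card κ ≤ (Fintype.card β * n +
      Fintype.card μ * Fintype.card β) + Fintype.card ξ * m + ∑ j, a j := by
    exact_mod_cast hfinal.trans hX₃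
  have hι : Fintype.card ι = Fintype.card β + Fintype.card μ + Fintype.card ξ := by
    simp [ι]
  rw [Fintype.card_sum] at hs
  rw [hs] at hsum
  rw [hι] at hsum hmain
  rcases eq_or_ne P.height ⊤ with htop | htop
  · rw [htop]; simp
  · obtain ⟨h, hh⟩ := ENat.ne_top_iff_exists.mp htop
    rw [← hh] at hcard ⊢
    have hcard' : Nat.card (CoeffIndex n δ) ≤ h + Nat.card κ := by exact_mod_cast hcard
    norm_cast
    rw [hn] at hmain ⊢
    nlinarith

end

section

/-! ### Cones over closed subsets of projective space -/

variable {n : ℕ}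

/-- The nonzero vectors representing the points of `B`. -/
def affineCone (B : Set (ℙ ℂ (Fin n → ℂ))) : Set (Fin n → ℂ) :=
  {y | ∃ h : y ≠ 0, Projectivization.mk ℂ y h ∈ B}

theorem rep_mem_affineCone {B : Set (ℙ ℂ (Fin n → ℂ))} {x : ℙ ℂ (Fin n → ℂ)} (hx : x ∈ B) :
    x.rep ∈ affineCone B :=
  ⟨x.rep_nonzero, by rwa [Projectivization.mk_rep]⟩

theorem eval_smul_of_isHomogeneous {e : ℕ} {F : MvPolynomial (Fin n) ℂ} (hF : F.IsHomogeneous e)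
    (a : ℂ) (y : Fin n → ℂ) :
    MvPolynomial.eval (a • y) F = a ^ e * MvPolynomial.eval y F := by
  rw [eval_eq_sum_monomials hF, eval_eq_sum_monomials hF, Finset.mul_sum]
  refine Finset.sum_congr rfl fun m _ => ?_
  simp only [Pi.smul_apply, smul_eq_mul, mul_pow, Finset.prod_mul_distrib,
    Finset.prod_pow_eq_pow_sum, ← finsupp_degree_eq_sum, m.2]
  ring

theorem smul_mem_affineCone {B : Set (ℙ ℂ (Fin n → ℂ))} {y : Fin n → ℂ} (hy : y ∈ affineCone B)
    {a : ℂ} (ha : a ≠ 0) : a • y ∈ affineCone B := by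
  obtain ⟨h, hB⟩ := hy
  refine ⟨smul_ne_zero ha h, ?_⟩
  convert hB using 1
  rw [Projectivization.mk_eq_mk_iff']
  exact ⟨a, rfl⟩

/-- A product of forms is a form, so the generating sets are closed under finite intersection and
form a basis. -/
theorem exists_basic_open {U : Set (ℙ ℂ (Fin n → ℂ))}
    (hU : @IsOpen _ (zariskiTopology n) U) {x : ℙ ℂ (Fin n → ℂ)} (hx : x ∈ U) :
    ∃ (F : MvPolynomial (Fin n) ℂ) (e : ℕ), F.IsHomogeneous e ∧ ¬ VanishesAt F x ∧
      ∀ z, ¬ VanishesAt F z → z ∈ U := by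
  have hU' : TopologicalSpace.GenerateOpen _ U := hU
  induction hU' with
  | basic s hs =>
    obtain ⟨F, e, hF, rfl⟩ := hs
    exact ⟨F, e, hF, hx, fun z hz => hz⟩
  | univ => exact ⟨1, 0, MvPolynomial.isHomogeneous_one _ _, by simp [VanishesAt], fun _ _ => trivial⟩
  | inter s t hs ht ihs iht =>
    obtain ⟨F, e, hF, hFx, hFs⟩ := ihs hs hx.1
    obtain ⟨G, e', hG, hGx, hGt⟩ := iht ht hx.2
    refine ⟨F * G, e + e', hF.mul hG, ?_, ?_⟩
    · simp only [VanishesAt, map_mul, mul_eq_zero, not_or] at hFx hGx ⊢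
      exact ⟨hFx, hGx⟩
    · intro z hz
      simp only [VanishesAt, map_mul, mul_eq_zero, not_or] at hz
      exact ⟨hFs z hz.1, hGt z hz.2⟩
  | sUnion S hS ih =>
    obtain ⟨s, hs, hxs⟩ := hx
    obtain ⟨F, e, hF, hFx, hFs⟩ := ih s hs (hS s hs) hxs
    exact ⟨F, e, hF, hFx, fun z hz => ⟨s, hs, hFs z hz⟩⟩

theorem exists_homogeneousComponent_ne_zero {f : MvPolynomial (Fin n) ℂ} {y : Fin n → ℂ}
    (h : MvPolynomial.eval y f ≠ 0) :
    ∃ d, MvPolynomial.eval y (MvPolynomial.homogeneousComponent d f) ≠ 0 := by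
  by_contra! h0
  apply h
  rw [← MvPolynomial.sum_homogeneousComponent f, map_sum]
  exact Finset.sum_eq_zero fun d _ => h0 d

/-- The restriction of a polynomial to a line through the origin. -/
def restrictLine (y : Fin n → ℂ) : MvPolynomial (Fin n) ℂ →ₐ[ℂ] Polynomial ℂ :=
  MvPolynomial.aeval fun t => Polynomial.C (y t) * Polynomial.X

theorem eval_restrictLine (y : Fin n → ℂ) (f : MvPolynomial (Fin n) ℂ) (a : ℂ) :
    (restrictLine y f).eval a = MvPolynomial.eval (a • y) f := by
  induction f using MvPolynomial.induction_on with
  | C b => simp [restrictLine]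
  | add p q hp hq => simp [hp, hq]
  | mul_X p t hp =>
    rw [map_mul, Polynomial.eval_mul, hp, map_mul]
    simp only [restrictLine, MvPolynomial.aeval_X, Polynomial.eval_mul, Polynomial.eval_C,
      Polynomial.eval_X, MvPolynomial.eval_X, Pi.smul_apply, smul_eq_mul]
    ring

theorem restrictLine_of_isHomogeneous {e : ℕ} {F : MvPolynomial (Fin n) ℂ} (hF : F.IsHomogeneous e)
    (y : Fin n → ℂ) :
    restrictLine y F = Polynomial.C (MvPolynomial.eval y F) * Polynomial.X ^ e := by
  apply Polynomial.funext
  intro a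
  rw [eval_restrictLine, eval_smul_of_isHomogeneous hF]
  simp only [Polynomial.eval_mul, Polynomial.eval_C, Polynomial.eval_pow, Polynomial.eval_X]
  ring

theorem restrictLine_ne_zero {f : MvPolynomial (Fin n) ℂ} {y : Fin n → ℂ} {d : ℕ}
    (h : MvPolynomial.eval y (MvPolynomial.homogeneousComponent d f) ≠ 0) :
    restrictLine y f ≠ 0 := by
  intro h0
  apply h
  have h1 := congrArg (fun P => Polynomial.coeff P d) h0
  simp only [Polynomial.coeff_zero] at h1
  rw [← MvPolynomial.sum_homogeneousComponent f, map_sum, Polynomial.finsetSum_coeff] at h1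
  simp only [restrictLine_of_isHomogeneous (MvPolynomial.homogeneousComponent_isHomogeneous _ f),
    Polynomial.coeff_C_mul, Polynomial.coeff_X_pow] at h1
  by_cases hd : d ∈ Finset.range (f.totalDegree + 1)
  · simpa [Finset.mem_range.mp hd] using h1
  · rw [MvPolynomial.homogeneousComponent_eq_zero _ _ (by
      have := Finset.mem_range.not.mp hd; omega), map_zero]

/-- Irreducibility of `B` concerns forms only. For arbitrary `f` and `g`, pick homogeneous
components that do not vanish on the cone and a point of `B` where both are nonzero. On the line
over this point `f` and `g` become nonzero polynomials in one variable, and some nonzero scalar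
avoids the roots of both. -/
theorem isIrreducibleCone_affineCone {B : Set (ℙ ℂ (Fin n → ℂ))}
    (hB : @IsIrreducible _ (zariskiTopology n) B) : IsIrreducibleCone (affineCone B) := by
  refine ⟨?_, ?_, ?_⟩
  · obtain ⟨x, hx⟩ := hB.1
    exact ⟨x.rep, rep_mem_affineCone hx⟩
  · rintro y ⟨h, -⟩
    exact h
  · rintro f g ⟨y, ⟨hy0, hy⟩, hfy⟩ ⟨z, ⟨hz0, hz⟩, hgz⟩
    obtain ⟨d, hd⟩ := exists_homogeneousComponent_ne_zero hfy
    obtain ⟨e, he⟩ := exists_homogeneousComponent_ne_zero hgz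
    have hdh := MvPolynomial.homogeneousComponent_isHomogeneous d f
    have heh := MvPolynomial.homogeneousComponent_isHomogeneous e g
    obtain ⟨x, hxB, hx1, hx2⟩ := hB.2
      {x | ¬ VanishesAt (MvPolynomial.homogeneousComponent d f) x}
      {x | ¬ VanishesAt (MvPolynomial.homogeneousComponent e g) x}
      (TopologicalSpace.isOpen_generateFrom_of_mem ⟨_, d, hdh, rfl⟩)
      (TopologicalSpace.isOpen_generateFrom_of_mem ⟨_, e, heh, rfl⟩)
      ⟨_, hy, fun h => hd ((vanishesAt_mk_iff hdh y hy0).mp h)⟩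
      ⟨_, hz, fun h => he ((vanishesAt_mk_iff heh z hz0).mp h)⟩
    have h1 := restrictLine_ne_zero hx1
    have h2 := restrictLine_ne_zero hx2
    obtain ⟨a, ha⟩ : ∃ a, (Polynomial.X * (restrictLine x.rep f * restrictLine x.rep g)).eval a ≠ 0 := by
      by_contra! h0
      exact mul_ne_zero Polynomial.X_ne_zero (mul_ne_zero h1 h2)
        (Polynomial.funext fun a => by rw [h0, Polynomial.eval_zero])
    rw [Polynomial.eval_mul, Polynomial.eval_mul, Polynomial.eval_X, eval_restrictLine,
      eval_restrictLine] at ha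
    obtain ⟨ha0, ha1, ha2⟩ : a ≠ 0 ∧ MvPolynomial.eval (a • x.rep) f ≠ 0 ∧
        MvPolynomial.eval (a • x.rep) g ≠ 0 := by
      simpa [not_or] using ha
    exact ⟨a • x.rep, smul_mem_affineCone (rep_mem_affineCone hxB) ha0, ha1, ha2⟩

attribute [local instance] MvPolynomial.gradedAlgebra

theorem mk_mem_zeros {Q : Ideal (MvPolynomial (Fin n) ℂ)}
    (hQ : Q.IsHomogeneous (MvPolynomial.homogeneousSubmodule (Fin n) ℂ)) {y : Fin n → ℂ}
    (hy : y ≠ 0) (h : ∀ F ∈ Q, MvPolynomial.eval y F = 0) (F) (hF : F ∈ Q) :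
    MvPolynomial.eval (Projectivization.mk ℂ y hy).rep F = 0 := by
  rw [← MvPolynomial.sum_homogeneousComponent F, map_sum]
  refine Finset.sum_eq_zero fun d _ => ?_
  have h1 : MvPolynomial.homogeneousComponent d F ∈ Q :=
    MvPolynomial.homogeneousComponent_mem_of_mem hQ hF d
  exact (vanishesAt_mk_iff (MvPolynomial.homogeneousComponent_isHomogeneous d F) y hy).mpr (h _ h1)

/-- The homogeneous prime ideal `Q` defines an irreducible closed set. -/
theorem isIrreducible_zeros {Q : Ideal (MvPolynomial (Fin n) ℂ)} [Q.IsPrime]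
    (hQ : Q.IsHomogeneous (MvPolynomial.homogeneousSubmodule (Fin n) ℂ))
    {B : Set (ℙ ℂ (Fin n → ℂ))} (hB : B = {x | ∀ F ∈ Q, MvPolynomial.eval x.rep F = 0})
    (hne : B.Nonempty) : @IsIrreducible _ (zariskiTopology n) B := by
  have hnot : ∀ {x F}, x ∈ B → ¬ VanishesAt F x → F ∉ Q := by
    rintro x F hx hF hFQ
    rw [hB] at hx
    exact hF (hx F hFQ)
  refine ⟨hne, ?_⟩
  rintro U V hU hV ⟨x, hxB, hxU⟩ ⟨z, hzB, hzV⟩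
  obtain ⟨F, d, hF, hFx, hFU⟩ := exists_basic_open hU hxU
  obtain ⟨G, e, hG, hGz, hGV⟩ := exists_basic_open hV hzV
  obtain ⟨t, ht⟩ := Function.ne_iff.mp x.rep_nonzero
  have hX : (MvPolynomial.X t : MvPolynomial (Fin n) ℂ) ∉ Q :=
    hnot hxB (by simpa [VanishesAt] using ht)
  -- The factor `X t` forces the zero of `Q` found below to be different from the origin.
  have hprod : F * G * MvPolynomial.X t ∉ Q := by
    rw [Ideal.IsPrime.mul_mem_iff_mem_or_mem ‹_›, Ideal.IsPrime.mul_mem_iff_mem_or_mem ‹_›]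
    simp [hnot hxB hFx, hnot hzB hGz, hX]
  rw [← MvPolynomial.IsPrime.vanishingIdeal_zeroLocus (K := ℂ) Q,
    MvPolynomial.mem_vanishingIdeal_iff] at hprod
  push Not at hprod
  obtain ⟨y, hy, hne⟩ := hprod
  have hyQ : ∀ F ∈ Q, MvPolynomial.eval y F = 0 := by
    simpa [MvPolynomial.mem_zeroLocus_iff, MvPolynomial.aeval_eq_eval] using hy
  simp only [MvPolynomial.aeval_eq_eval, map_mul, MvPolynomial.eval_X, ne_eq,
    mul_eq_zero, not_or] at hne
  have hy0 : y ≠ 0 := fun h => hne.2 (by simp [h])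
  refine ⟨Projectivization.mk ℂ y hy0, ?_, hFU _ ?_, hGV _ ?_⟩
  · rw [hB]
    exact mk_mem_zeros hQ hy0 hyQ
  · rw [vanishesAt_mk_iff hF]
    exact hne.1.1
  · rw [vanishesAt_mk_iff hG]
    exact hne.1.2


theorem eval_eq_zero_of_mem_affineCone {r : ℕ} {δ : Fin r → ℕ} {p : ParamSpace n δ} {j : Fin r}
    {B : Set (ℙ ℂ (Fin n → ℂ))}
    (h : ∀ x ∈ B, VanishesAt (p j : MvPolynomial (Fin n) ℂ) x) {y : Fin n → ℂ}
    (hy : y ∈ affineCone B) : MvPolynomial.eval y (p j : MvPolynomial (Fin n) ℂ) = 0 := by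
  obtain ⟨hy0, hy⟩ := hy
  exact (vanishesAt_mk_iff (isHomogeneous_paramSpace p j) y hy0).mp (h _ hy)

/-- A component of a set defined by `i` equations has codimension at most `i`. -/
theorem IsComponent.height_le {r : ℕ} {δ : Fin r → ℕ} {p : ParamSpace n δ} {i : Fin r}
    {B : Set (ℙ ℂ (Fin n → ℂ))} (hB : IsComponent B (zerosBefore p i)) :
    (MvPolynomial.vanishingIdeal ℂ (affineCone B)).height ≤ (i : ℕ) := by
  classical
  have hC := isIrreducibleCone_affineCone hB.prop.1
  have hprime := hC.isPrime_vanishingIdeal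
  set 𝔭 := MvPolynomial.vanishingIdeal ℂ (affineCone B) with h𝔭
  let G : Finset (MvPolynomial (Fin n) ℂ) := (Finset.Iio i).image fun j => (p j).1
  have hG : Ideal.span (G : Set (MvPolynomial (Fin n) ℂ)) ≤ 𝔭 := by
    rw [Ideal.span_le]
    intro g hg
    obtain ⟨j, hj, rfl⟩ := Finset.mem_image.mp (Finset.mem_coe.mp hg)
    refine mem_vanishingIdeal_iff_eval.mpr fun y hy => ?_
    exact eval_eq_zero_of_mem_affineCone (fun x hx => hB.prop.2 hx j (Finset.mem_Iio.mp hj)) hy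
  obtain ⟨Q, hQmin, hQ𝔭⟩ := Ideal.exists_minimalPrimes_le hG
  have hQprime : Q.IsPrime := hQmin.1.1
  have hheight : Q.height ≤ (i : ℕ) := by
    refine (Ideal.height_le_card_of_mem_minimalPrimes_span_finset hQmin).trans ?_
    have : G.card ≤ (i : ℕ) := Finset.card_image_le.trans (by simp)
    exact_mod_cast this
  have hGhom : (Ideal.span (G : Set (MvPolynomial (Fin n) ℂ))).IsHomogeneous
      (MvPolynomial.homogeneousSubmodule (Fin n) ℂ) := by
    refine Ideal.homogeneous_span _ _ fun g hg => ?_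
    obtain ⟨j, -, rfl⟩ := Finset.mem_image.mp (Finset.mem_coe.mp hg)
    exact ⟨_, (p j).2⟩
  have hQhom : Q.IsHomogeneous (MvPolynomial.homogeneousSubmodule (Fin n) ℂ) := by
    have hle : Ideal.span (G : Set (MvPolynomial (Fin n) ℂ)) ≤
        (Q.homogeneousCore (MvPolynomial.homogeneousSubmodule (Fin n) ℂ)).toIdeal := by
      rw [← hGhom.toIdeal_homogeneousCore_eq_self]
      exact Ideal.homogeneousCore_mono _ hQmin.1.2
    -- A minimal prime over a homogeneous ideal equals its homogeneous core, which is again a prime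
    -- over that ideal.
    have hcore := hQmin.2 ⟨hQprime.homogeneousCore, hle⟩
      (Ideal.toIdeal_homogeneousCore_le _ Q)
    have heq := le_antisymm (Ideal.toIdeal_homogeneousCore_le
      (MvPolynomial.homogeneousSubmodule (Fin n) ℂ) Q) hcore
    rw [← heq]
    exact HomogeneousIdeal.isHomogeneous _
  let B' : Set (ℙ ℂ (Fin n → ℂ)) := {x | ∀ F ∈ Q, MvPolynomial.eval x.rep F = 0}
  have hBB' : B ⊆ B' := fun x hx F hF =>
    mem_vanishingIdeal_iff_eval.mp (hQ𝔭 hF) _ (rep_mem_affineCone hx)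
  -- The zero set of `Q` is irreducible, contains `B` and lies in the closed set, so maximality of
  -- the component gives equality.
  have hB'B : B' ⊆ B := by
    refine hB.2 ⟨isIrreducible_zeros hQhom rfl (hB.prop.1.1.mono hBB'), ?_⟩ hBB'
    intro x hx j hj
    refine hx _ (hQmin.1.2 (Ideal.subset_span (Finset.mem_coe.mpr (Finset.mem_image.mpr ?_))))
    exact ⟨j, Finset.mem_Iio.mpr hj, rfl⟩
  obtain ⟨z, hz⟩ := hC.nonempty
  obtain ⟨t, ht⟩ := Function.ne_iff.mp (hC.ne_zero z hz)
  have hX : (MvPolynomial.X t : MvPolynomial (Fin n) ℂ) ∉ Q := fun h =>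
    ht (by simpa using mem_vanishingIdeal_iff_eval.mp (hQ𝔭 h) z hz)
  refine (Ideal.height_mono fun f hf => ?_).trans hheight
  -- The cone omits the origin, where `f` might not vanish; the factor `X t` deals with that point
  -- and is then cancelled, since `X t ∉ Q`.
  have hmul : f * MvPolynomial.X t ∈ Q := by
    rw [← MvPolynomial.IsPrime.vanishingIdeal_zeroLocus (K := ℂ) Q, mem_vanishingIdeal_iff_eval]
    intro y hy
    have hyQ : ∀ F ∈ Q, MvPolynomial.eval y F = 0 := by
      simpa [MvPolynomial.mem_zeroLocus_iff, MvPolynomial.aeval_eq_eval] using hy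
    by_cases hy0 : y = 0
    · simp [hy0]
    · rw [map_mul, mem_vanishingIdeal_iff_eval.mp hf y ⟨hy0, hB'B (mk_mem_zeros hQhom hy0 hyQ)⟩,
        zero_mul]
  exact (hQprime.mem_or_mem hmul).resolve_right hX

end

section

/-! ### Systems of parameters consisting of linear forms -/

variable {n : ℕ}

/-- The linear form with given coefficients. -/
def linearForm : (Fin n → ℂ) →ₗ[ℂ] MvPolynomial (Fin n) ℂ :=
  Fintype.linearCombination ℂ MvPolynomial.X

theorem isHomogeneous_linearForm (v : Fin n → ℂ) : (linearForm v).IsHomogeneous 1 := by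
  rw [linearForm, Fintype.linearCombination_apply]
  refine MvPolynomial.IsHomogeneous.sum _ _ _ fun t _ => ?_
  rw [MvPolynomial.smul_eq_C_mul]
  exact MvPolynomial.isHomogeneous_C_mul_X _ _

theorem card_le_height_of_X_mem {P : Ideal (MvPolynomial (Fin n) ℂ)} [P.IsPrime]
    (h : ∀ t, MvPolynomial.X t ∈ P) : (n : ℕ∞) ≤ P.height := by
  obtain ⟨κ, _, u, hu, hle⟩ := exists_independent_variables (Fin n) P
  have : IsEmpty κ := by
    refine ⟨fun k => MvPolynomial.X_ne_zero (R := ℂ) k (hu _ ?_)⟩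
    rw [MvPolynomial.rename_X]
    exact h _
  simpa using hle

/-- A general linear form cuts down the dimension of a positive-dimensional cone. -/
theorem exists_linearForm_height_succ {J : Ideal (MvPolynomial (Fin n) ℂ)} {h : ℕ}
    (hJ : (h : ℕ∞) ≤ J.height) (hn : h + 1 ≤ n) :
    ∃ v : Fin n → ℂ, ((h + 1 : ℕ) : ℕ∞) ≤ (J ⊔ Ideal.span {linearForm v}).height := by
  classical
  let V : Ideal (MvPolynomial (Fin n) ℂ) → Subspace ℂ (Fin n → ℂ) := fun P =>
    (P.restrictScalars ℂ).comap linearForm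
  have hfin := J.finite_minimalPrimes_of_isNoetherianRing (MvPolynomial (Fin n) ℂ)
  -- The linear form avoids all minimal primes of `J` except those containing every linear form; the
  -- latter have height at least `n ≥ h + 1` anyway.
  obtain ⟨v, hv⟩ := (Set.ne_univ_iff_exists_notMem _).mp
    (Subspace.biUnion_ne_univ_of_top_notMem
      (s := (hfin.toFinset.image V).filter (· ≠ ⊤)) (by simp))
  refine ⟨v, ?_⟩
  rw [Ideal.height_eq_inf_minimalPrimes]
  refine le_iInf₂ fun P hP => ?_
  have := hP.isPrime
  obtain ⟨Q, hQ, hQP⟩ := Ideal.exists_minimalPrimes_le (le_sup_left.trans hP.le)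
  have := hQ.isPrime
  by_cases hX : ∀ t, MvPolynomial.X t ∈ Q
  · exact le_trans (by exact_mod_cast hn) ((card_le_height_of_X_mem hX).trans (Ideal.height_mono hQP))
  · have hvQ : linearForm v ∉ Q := by
      intro hmem
      apply hv
      simp only [Set.mem_iUnion]
      refine ⟨V Q, ?_, hmem⟩
      simp only [Finset.mem_filter, Finset.mem_image, Set.Finite.mem_toFinset]
      refine ⟨⟨Q, hQ, rfl⟩, fun htop => hX fun t => ?_⟩
      have : Pi.single t 1 ∈ V Q := htop ▸ Submodule.mem_top
      simpa [V, linearForm, Fintype.linearCombination_apply_single] using this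
    have hlt : Q < P := by
      refine lt_of_le_of_ne hQP ?_
      rintro rfl
      exact hvQ (hP.le (Ideal.mem_sup_right (Ideal.subset_span rfl)))
    refine le_trans ?_ (Ideal.height_add_one_le_of_lt_of_isPrime hlt)
    push_cast
    gcongr
    exact hJ.trans (Ideal.height_mono hQ.le)

theorem exists_linearForms_height {J : Ideal (MvPolynomial (Fin n) ℂ)} {h : ℕ}
    (hJ : (h : ℕ∞) ≤ J.height) (m : ℕ) (hn : h + m ≤ n) :
    ∃ v : Fin m → Fin n → ℂ,
      ((h + m : ℕ) : ℕ∞) ≤ (J ⊔ Ideal.span (Set.range fun u => linearForm (v u))).height := by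
  induction m with
  | zero => exact ⟨Fin.elim0, hJ.trans (Ideal.height_mono le_sup_left)⟩
  | succ m ih =>
    obtain ⟨v, hv⟩ := ih (by omega)
    obtain ⟨w, hw⟩ := exists_linearForm_height_succ hv (by omega)
    refine ⟨Fin.snoc v w, hw.trans (Ideal.height_mono ?_)⟩
    refine sup_le (sup_le le_sup_left ?_) ?_
    · refine le_sup_of_le_right (Ideal.span_mono ?_)
      rintro _ ⟨u, rfl⟩
      exact ⟨u.castSucc, by simp⟩
    · refine le_sup_of_le_right (Ideal.span_mono ?_)
      rintro _ rfl
      exact ⟨Fin.last m, by simp⟩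

attribute [local instance] MvPolynomial.gradedAlgebra

/-- A homogeneous ideal of full height has no nontrivial zeros. -/
theorem eq_zero_of_le_height {J : Ideal (MvPolynomial (Fin n) ℂ)}
    (hJ : J.IsHomogeneous (MvPolynomial.homogeneousSubmodule (Fin n) ℂ))
    (hn : (n : ℕ∞) ≤ J.height) {y : Fin n → ℂ} (hy : ∀ F ∈ J, MvPolynomial.eval y F = 0) :
    y = 0 := by
  by_contra hy0
  obtain ⟨t, ht⟩ := Function.ne_iff.mp hy0
  -- A nonzero zero `y` would put `J` inside the prime ideal of the line through `y`. That prime is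
  -- strictly contained in the ideal of the point `y`, whose height is at most `n`, so `J` would
  -- have height less than `n`.
  have hJker : J ≤ RingHom.ker (restrictLine y) := by
    intro F hF
    rw [RingHom.mem_ker, ← MvPolynomial.sum_homogeneousComponent F, map_sum]
    refine Finset.sum_eq_zero fun d _ => ?_
    rw [restrictLine_of_isHomogeneous (MvPolynomial.homogeneousComponent_isHomogeneous d F),
      hy _ (MvPolynomial.homogeneousComponent_mem_of_mem hJ hF d), map_zero, zero_mul]
  have hprime := RingHom.ker_isPrime (restrictLine y)
  have hprime' := RingHom.ker_isPrime (MvPolynomial.eval y)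
  have hlt : RingHom.ker (restrictLine y) < RingHom.ker (MvPolynomial.eval y) := by
    refine lt_of_le_of_ne (fun F hF => ?_) fun heq => ?_
    · have := eval_restrictLine y F 1
      rw [one_smul, RingHom.mem_ker.mp hF, Polynomial.eval_zero] at this
      exact this.symm
    · have hmem : MvPolynomial.X t - MvPolynomial.C (y t) ∈ RingHom.ker (restrictLine y) := by
        rw [heq, RingHom.mem_ker]
        simp
      have h0 := eval_restrictLine y (MvPolynomial.X t - MvPolynomial.C (y t)) 0
      rw [RingHom.mem_ker.mp hmem] at h0
      simp at h0
      exact ht h0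
  have h1 := Ideal.height_add_one_le_of_lt_of_isPrime hlt
  have h2 := Ideal.height_le_ringKrullDim_of_ne_top hprime'.ne_top
  rw [MvPolynomial.ringKrullDim_of_isNoetherianRing, ringKrullDim_eq_zero_of_field, zero_add,
    Nat.card_fin] at h2
  have h3 : (RingHom.ker (MvPolynomial.eval y)).height ≤ (n : ℕ∞) := by exact_mod_cast h2
  have h4 := (add_le_add_left (hn.trans (Ideal.height_mono hJker)) 1).trans (h1.trans h3)
  have h5 : n + 1 ≤ n := by exact_mod_cast h4
  omega

/-- A closed set of codimension `h` does not meet a suitable linear subspace of codimension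
`n - h`. -/
theorem exists_linearForms {J : Ideal (MvPolynomial (Fin n) ℂ)}
    (hhom : J.IsHomogeneous (MvPolynomial.homogeneousSubmodule (Fin n) ℂ)) {h m : ℕ}
    (hJ : (h : ℕ∞) ≤ J.height) (hn : n = h + m) :
    ∃ lam : Fin m → MvPolynomial (Fin n) ℂ, (∀ u, (lam u).IsHomogeneous 1) ∧
      ∀ y, (∀ F ∈ J, MvPolynomial.eval y F = 0) → (∀ u, MvPolynomial.eval y (lam u) = 0) →
        y = 0 := by
  obtain ⟨v, hv⟩ := exists_linearForms_height hJ m hn.ge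
  rw [← hn] at hv
  refine ⟨fun u => linearForm (v u), fun u => isHomogeneous_linearForm _, fun y hy hlam => ?_⟩
  refine eq_zero_of_le_height (hhom.sup (Ideal.homogeneous_span _ _ ?_)) hv fun F hF => ?_
  · rintro _ ⟨u, rfl⟩
    exact ⟨1, isHomogeneous_linearForm _⟩
  · have hle : J ⊔ Ideal.span (Set.range fun u => linearForm (v u)) ≤
        RingHom.ker (MvPolynomial.eval y) := by
      refine sup_le (fun F hF => hy F hF) (Ideal.span_le.mpr ?_)
      rintro _ ⟨u, rfl⟩
      exact hlam u
    exact hle hF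

/-- Near a tuple whose first polynomials define a set of the correct dimension, monomials can be
expressed through these polynomials and suitable linear forms. -/
theorem exists_multipliers {r : ℕ} {δ : Fin r → ℕ} (p : ParamSpace n δ) {i : Fin r} {m : ℕ}
    (hn : n = i + m) (hcodim : projCodim (zerosBefore p i) = ((i : ℕ) : ℕ∞)) :
    ∃ (c : Multipliers δ n m i) (lam : Fin m → MvPolynomial (Fin n) ℂ),
      (∀ u, (lam u).IsHomogeneous 1) ∧
      MvPolynomial.eval (coords p) (c.matrix lam).det ≠ 0 := by
  classical
  have hhom : (homogIdeal (zerosBefore p i)).IsHomogeneous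
      (MvPolynomial.homogeneousSubmodule (Fin n) ℂ) :=
    Ideal.homogeneous_span _ _ fun F hF => hF.1
  obtain ⟨lam, hlam, hzero⟩ := exists_linearForms hhom (h := i) hcodim.ge hn
  obtain ⟨D, hD, c, hc1, hc2, hc3⟩ := exists_monomial_combination
    (Sum.elim (fun j : {j : Fin r // j < i} => δ j) fun _ : Fin m => 1)
    (Sum.elim (fun j : {j : Fin r // j < i} => (p j.1 : MvPolynomial (Fin n) ℂ)) lam)
    (by rintro (j | u); exacts [isHomogeneous_paramSpace p j.1, hlam u])
    (by
      intro y hy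
      by_contra hy0
      refine hy0 (hzero y (fun F hF => ?_) fun u => hy (Sum.inr u))
      have hle : homogIdeal (zerosBefore p i) ≤ RingHom.ker (MvPolynomial.eval y) := by
        refine Ideal.span_le.mpr ?_
        rintro F ⟨⟨e, hF⟩, hvan⟩
        refine (vanishesAt_mk_iff hF y hy0).mp (hvan _ fun j hj => ?_)
        exact (vanishesAt_mk_iff (isHomogeneous_paramSpace p j) y hy0).mpr (hy (Sum.inl ⟨j, hj⟩))
      exact hle hF)
  refine ⟨⟨D, hD, fun μ j => c μ (Sum.inl j), fun μ u => c μ (Sum.inr u),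
    fun μ j q hq => hc1 μ (Sum.inl j) q hq, fun μ u => hc2 μ (Sum.inr u)⟩, lam, hlam, ?_⟩
  rw [RingHom.map_det]
  refine ne_of_eq_of_ne (Eq.trans (congrArg Matrix.det (a₂ := 1) ?_) Matrix.det_one) one_ne_zero
  ext μ ν
  rw [RingHom.mapMatrix_apply, Matrix.map_apply, Multipliers.eval_matrix, Multipliers.combination]
  have := hc3 μ
  rw [Fintype.sum_sum_type] at this
  simp only [Sum.elim_inl, Sum.elim_inr] at this
  dsimp only
  rw [← this, MvPolynomial.coeff_monomial, Matrix.one_apply]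
  simp [Subtype.ext_iff]

end

section

/-! ### The linear span of a set of degree at least two -/

variable {n : ℕ}

theorem exists_linearForm_of_ne {x y : ℙ ℂ (Fin n → ℂ)} (h : x ≠ y) :
    ∃ f : MvPolynomial (Fin n) ℂ, f.IsHomogeneous 1 ∧ MvPolynomial.eval x.rep f = 0 ∧
      MvPolynomial.eval y.rep f ≠ 0 := by
  have hy : y.rep ∉ Submodule.span ℂ {x.rep} := by
    intro hmem
    obtain ⟨a, ha⟩ := Submodule.mem_span_singleton.mp hmem
    apply h
    rw [← x.mk_rep, ← y.mk_rep, eq_comm, Projectivization.mk_eq_mk_iff']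
    exact ⟨a, ha⟩
  obtain ⟨φ, hφ, hker⟩ := Submodule.exists_le_ker_of_notMem hy
  obtain ⟨f, hf, hfφ⟩ := exists_linearForm φ
  exact ⟨f, hf, (hfφ _).trans (hker (Submodule.mem_span_singleton_self _)), by rwa [hfφ]⟩

/-- With two distinct points `x`, `y`, a product of linear forms vanishing at every point of `B` but
`x`, and a linear form vanishing at `x` but not at `y`, would contradict irreducibility. -/
theorem subsingleton_of_isIrreducible_of_finite {B : Set (ℙ ℂ (Fin n → ℂ))}
    (hB : @IsIrreducible _ (zariskiTopology n) B) (hfin : B.Finite) : B.Subsingleton := by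
  classical
  intro x hx y hy
  by_contra hxy
  choose! ℓ hℓ hℓ0 hℓne using fun w (hw : w ≠ x) => exists_linearForm_of_ne hw
  obtain ⟨g, hg, hg0, hgne⟩ := exists_linearForm_of_ne hxy
  let f := ∏ w ∈ hfin.toFinset.erase x, ℓ w
  obtain ⟨z, ⟨hz0, hz⟩, hfz, hgz⟩ := (isIrreducibleCone_affineCone hB).irreducible f g
    ⟨x.rep, rep_mem_affineCone hx, by
      rw [map_prod, Finset.prod_ne_zero_iff]
      exact fun w hw => hℓne w (Finset.ne_of_mem_erase hw)⟩
    ⟨y.rep, rep_mem_affineCone hy, hgne⟩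
  by_cases hzx : Projectivization.mk ℂ z hz0 = x
  · rw [← hzx] at hg0
    exact hgz ((vanishesAt_mk_iff hg z hz0).mp hg0)
  · apply hfz
    rw [map_prod]
    refine Finset.prod_eq_zero (i := Projectivization.mk ℂ z hz0)
      (Finset.mem_erase.mpr ⟨hzx, hfin.mem_toFinset.mpr hz⟩) ?_
    exact (vanishesAt_mk_iff (hℓ _ hzx) z hz0).mp (hℓ0 _ hzx)

/-- An irreducible set that is neither a point nor a line spans a space of dimension at least
three. -/
theorem three_le_finrank_span {B : Set (ℙ ℂ (Fin n → ℂ))}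
    (hB : @IsIrreducible _ (zariskiTopology n) B) (hdeg : 2 ≤ projDegree B) :
    3 ≤ Module.finrank ℂ (Submodule.span ℂ (affineCone B)) := by
  obtain ⟨W, hfin, hcard⟩ : ∃ W : Submodule ℂ (Fin n → ℂ), (B ∩ linearSubspace W).Finite ∧
      1 < (B ∩ linearSubspace W).encard := by
    by_contra! h
    have : projDegree B ≤ 1 := iSup_le fun W => iSup₂_le fun _ hfin => h W hfin
    exact absurd (hdeg.trans this) (by decide)
  obtain ⟨x, y, ⟨hxB, hxW⟩, ⟨hyB, hyW⟩, hxy⟩ := Set.one_lt_encard_iff.mp hcard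
  by_contra! hlt
  have hli : LinearIndependent ℂ ![x.rep, y.rep] := by
    rw [LinearIndependent.pair_iff' x.rep_nonzero]
    intro a ha
    apply hxy
    rw [← x.mk_rep, ← y.mk_rep, eq_comm, Projectivization.mk_eq_mk_iff']
    exact ⟨a, ha⟩
  have hle : Submodule.span ℂ (Set.range ![x.rep, y.rep]) ≤ Submodule.span ℂ (affineCone B) := by
    refine Submodule.span_mono ?_
    rintro _ ⟨u, rfl⟩
    fin_cases u
    exacts [rep_mem_affineCone hxB, rep_mem_affineCone hyB]
  have hspan := Submodule.eq_of_le_of_finrank_le hle (by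
    rw [finrank_span_eq_card hli, Fintype.card_fin]
    omega)
  -- If the span had dimension at most 2, it would be generated by the two points found in `W`; then
  -- all of `B` would lie in `W` and be finite.
  have hW : Submodule.span ℂ (affineCone B) ≤ W := by
    rw [← hspan, Submodule.span_le]
    rintro _ ⟨u, rfl⟩
    have hmem : ∀ z : ℙ ℂ (Fin n → ℂ), z ∈ linearSubspace W → z.rep ∈ W := fun z hz =>
      hz (by rw [Projectivization.submodule_eq]; exact Submodule.mem_span_singleton_self _)
    fin_cases u
    exacts [hmem x hxW, hmem y hyW]
  refine hxy (subsingleton_of_isIrreducible_of_finite hB (hfin.subset ?_) hxB hyB)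
  intro z hz
  refine ⟨hz, ?_⟩
  change z.submodule ≤ W
  rw [Projectivization.submodule_eq, Submodule.span_singleton_le_iff_mem]
  exact hW (Submodule.subset_span (rep_mem_affineCone hz))

end

section

/-! ### Choosing the numbers of points -/

variable {n : ℕ} {C : Set (Fin n → ℂ)} {m : ℕ} {lam : Fin m → MvPolynomial (Fin n) ℂ}

theorem le_finrank_span_of_independent (hlam1 : ∀ u, (lam u).IsHomogeneous 1)
    (hlam : ∀ f : MvPolynomial (Fin m) ℂ, f ≠ 0 →
      ∃ y ∈ C, MvPolynomial.eval (fun u => MvPolynomial.eval y (lam u)) f ≠ 0) :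
    m ≤ Module.finrank ℂ (Submodule.span ℂ C) := by
  classical
  have h := (hasIndependentForms_monomials hlam1 hlam 1).card_le_finrank_span
  refine le_trans ?_ h
  have := Fintype.card_le_of_injective
    (fun u : Fin m => (⟨Finsupp.single u 1, by simp⟩ : {κ : Fin m →₀ ℕ // κ.degree = 1}))
    (fun u v huv => Finsupp.single_left_injective one_ne_zero (Subtype.ext_iff.mp huv))
  simpa using this

/-- Numbers of intermediate points `q` and of additional points `x` for which the estimate of the
codimension is sufficient, provided that the cone spans a space of dimension `E`. -/
theorem exists_numbers_of_points {r k E : ℕ} (hk : 2 ≤ k) (hr : 2 * k + 1 ≤ r) (hn : n = r + 1)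
    {δ : Fin r → ℕ} (h2 : ∀ j, 2 ≤ δ j) (h3 : ∀ j : Fin r, k ≤ j → 3 ≤ δ j)
    (h4 : ∀ j : Fin r, 2 * k ≤ j → 4 ≤ δ j) (i : Fin r) (him : n = i + m) (hEn : E ≤ n)
    (hmE : m ≤ E) (hlast : (i : ℕ) + 1 = r → 3 ≤ E) :
    ∃ q x : ℕ, 2 * r + 4 + E * q ≤ q * n + (E + q + x) ∧
      ∀ (C : Set (Fin n → ℂ)) (lam : Fin m → MvPolynomial (Fin n) ℂ), IsIrreducibleCone C →
        (∀ u, (lam u).IsHomogeneous 1) →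
        (∀ f : MvPolynomial (Fin m) ℂ, f ≠ 0 →
          ∃ y ∈ C, MvPolynomial.eval (fun u => MvPolynomial.eval y (lam u)) f ≠ 0) →
        Module.finrank ℂ (Submodule.span ℂ C) = E →
        (∀ j < i, HasIndependentForms C (δ j) (Fin E ⊕ Fin q)) ∧
        HasIndependentForms C (δ i) ((Fin E ⊕ Fin q) ⊕ Fin x) := by
  subst hn
  obtain ⟨e, rfl⟩ : ∃ e, E = e + 1 := ⟨E - 1, by omega⟩
  have hir := i.2
  -- For `i < k` the dimension `m` is large: `2 m ≥ r + 5`, so the quadratic monomials in `m`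
  -- independent linear forms already suffice without intermediate points. The maximum makes the
  -- number of points at least `E`, as the spanning points demand.
  rcases lt_or_ge (i : ℕ) k with hik | hik
  · refine ⟨0, max ((m + 1).choose 2) (e + 1) - (e + 1), ?_, ?_⟩
    · have h1 : (m + 1).choose 2 * 2 = (m + 1) * m := by
        have := Nat.add_one_mul_choose_eq m 1
        simpa using this.symm
      have h5 : (m + 1) * m ≥ 4 * r + 8 := by
        have : 2 * m ≥ r + 5 := by omega
        nlinarith
      omega
    · intro C lam hC hlam1 hlam hE
      have hlin := hasIndependentForms_finrank_span C
      rw [hE] at hlin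
      refine ⟨fun j _ => (hlin.of_le hC (by have := h2 j; omega)).of_card_le (by simp), ?_⟩
      rcases le_total ((m + 1).choose 2) (e + 1) with hle | hle
      · exact (hlin.of_le hC (by have := h2 i; omega)).of_card_le (by simp [hle])
      · refine ((hasIndependentForms_monomials hlam1 hlam 2).of_le hC (h2 i)).of_card_le ?_
        refine le_trans ?_ (card_monomials_two m)
        simp [hle]
  · by_cases hcase : 3 ≤ e ∨ 4 ≤ δ i
    · have ha := h3 i hik
      -- Here `E ≥ m ≥ 3` unless `i` is the last index, where `hlast` applies.
      have he2 : 2 ≤ e := by omega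
      obtain ⟨a, ha'⟩ : ∃ a, δ i = a + 2 := ⟨δ i - 2, by omega⟩
      refine ⟨e, a * e, ?_, ?_⟩
      -- The number of points is `2 e + 1` in degree 2 and `δ i * e + 1` in degree `δ i`. With `a =
      -- δ i - 2` the required inequality reduces to `(e - 2) g + a e ≥ 3`, which fails only for `e
      -- = 2`, `a = 1`, the case treated separately below.
      · obtain ⟨g, hg⟩ : ∃ g, r = e + g := ⟨r - e, by omega⟩
        subst hg
        rcases hcase with h | h
        · have : 1 * e ≤ a * e := Nat.mul_le_mul_right _ (by omega)
          nlinarith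
        · have : 2 * e ≤ a * e := Nat.mul_le_mul_right _ (by omega)
          nlinarith
      · intro C lam hC hlam1 hlam hE
        have hlin := hasIndependentForms_finrank_span C
        rw [hE] at hlin
        refine ⟨fun j _ => ((hlin.pow_degree hC 2).of_le hC (h2 j)).of_card_le ?_,
          (hlin.pow_degree hC (δ i)).of_card_le ?_⟩
        · simp
          omega
        · simp [ha']
          ring_nf
          omega
    · have ha := h3 i hik
      have hi2 : ¬ 2 * k ≤ (i : ℕ) := fun h => hcase (Or.inr (h4 i h))
      -- Now `E = m = 3`. The six quadratic monomials in three independent linear forms allow `3 +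
      -- 3` points in degree 2, and degree 3 allows `3 * 2 + 1 = 7` points.
      obtain ⟨rfl, rfl⟩ : e = 2 ∧ m = 3 := by omega
      refine ⟨3, 1, by omega, ?_⟩
      intro C lam hC hlam1 hlam hE
      have hlin := hasIndependentForms_finrank_span C
      rw [hE] at hlin
      refine ⟨fun j _ => ((hasIndependentForms_monomials hlam1 hlam 2).of_le hC (h2 j)).of_card_le ?_,
        ((hlin.pow_degree hC 3).of_le hC ha).of_card_le (by simp)⟩
      refine le_trans ?_ (card_monomials_two 3)
      simp [Nat.choose]

/-- The polynomials of the first kind vanish in general position on an irreducible cone. -/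
theorem exists_isGeneralZero {r : ℕ} {δ : Fin r → ℕ} {i : Fin r} {β μ ξ : Type} [Fintype β]
    [Fintype μ] [Fintype ξ] [DecidableEq β] [DecidableEq μ] [DecidableEq ξ]
    (hC : IsIrreducibleCone C) (hβ : Fintype.card β = Module.finrank ℂ (Submodule.span ℂ C))
    (hlam : ∀ f : MvPolynomial (Fin m) ℂ, f ≠ 0 →
      ∃ y ∈ C, MvPolynomial.eval (fun u => MvPolynomial.eval y (lam u)) f ≠ 0)
    (hJ : ∀ j < i, HasIndependentForms C (δ j) (β ⊕ μ))
    (ha : HasIndependentForms C (δ i) ((β ⊕ μ) ⊕ ξ)) {p : ParamSpace n δ}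
    (hp : ∀ j ≤ i, ∀ y ∈ C, MvPolynomial.eval y (p j : MvPolynomial (Fin n) ℂ) = 0)
    {f : MvPolynomial (((β ⊕ μ) ⊕ ξ) × Fin m) ℂ} (hf : f ≠ 0) :
    ∃ Y : (β ⊕ μ) ⊕ ξ → Fin n → ℂ, IsGeneralZero i p Y ∧
      MvPolynomial.eval (fun k => MvPolynomial.eval (Y k.1) (lam k.2)) f ≠ 0 := by
  obtain ⟨Y, hYC, hYf, hspan, hbefore, hind⟩ := exists_general_points hC hβ hlam (Finset.Iio i) δ
    (fun j hj => hJ j (Finset.mem_Iio.mp hj)) ha hf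
  exact ⟨Y, ⟨fun l j hj => hp j hj _ (hYC l), hspan,
    fun j hj => hbefore j (Finset.mem_Iio.mpr hj), hind⟩, hYf⟩

end

section

/-! ### Lower bounds for the degrees -/

/-- An entry `v` is preceded only by values from `s` to `v`, each of which occurs at most `k` times.
-/
theorem lt_of_getElem?_flatMap_replicate {k : ℕ} {c : ℕ → ℕ} (hc : ∀ j, c j ≤ k) (len : ℕ) :
    ∀ s t v : ℕ, ((List.range' s len).flatMap fun j => List.replicate (c j) j)[t]? = some v →
      s ≤ v ∧ t < (v + 1 - s) * k := by
  induction len with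
  | zero => simp
  | succ len ih =>
    intro s t v h
    rw [List.range'_succ, List.flatMap_cons, List.getElem?_append, List.length_replicate] at h
    split_ifs at h with ht
    · rw [List.getElem?_replicate, if_pos ht, Option.some_inj] at h
      subst h
      have := hc s
      simp
      omega
    · obtain ⟨h1, h2⟩ := ih _ _ _ h
      obtain ⟨w, rfl⟩ : ∃ w, v = s + 1 + w := ⟨v - (s + 1), by omega⟩
      have h3 := hc s
      have e1 : s + 1 + w + 1 - (s + 1) = w + 1 := by omega
      have e2 : s + 1 + w + 1 - s = w + 1 + 1 := by omega
      rw [e1] at h2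
      rw [e2, Nat.add_mul (w + 1)]
      omega

theorem map_snd_filter_standardOrder {k : ℕ} (d : Fin k → ℕ) (hd : 0 < ∑ m, d m) :
    ((standardOrder d).filter fun a => 2 ≤ a.2).map Prod.snd =
      (List.range' 2 (∑ m, d m - 1)).flatMap fun j =>
        List.replicate ((List.finRange k).filter fun m => j ≤ d m).length j := by
  obtain ⟨D, hD⟩ : ∃ D, ∑ m, d m = D + 1 := ⟨∑ m, d m - 1, by omega⟩
  rw [standardOrder, hD, List.range'_succ, List.flatMap_cons, List.filter_append, List.map_append,
    List.filter_flatMap, List.map_flatMap, Nat.add_sub_cancel]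
  have hsmall : ∀ l : List (Fin k), ((l.map fun m => (m, 1)).filter
      fun a : Fin k × ℕ => 2 ≤ a.2) = [] := by
    intro l
    simp [List.filter_map]
  have hlarge : ∀ (l : List (Fin k)) (j : ℕ), 2 ≤ j → ((l.map fun m => (m, j)).filter
      fun a : Fin k × ℕ => 2 ≤ a.2).map Prod.snd = List.replicate l.length j := by
    intro l j hj
    induction l with
    | nil => simp
    | cons a t ih => simp [hj, List.replicate_succ] at ih ⊢; exact ih
  rw [hsmall, List.map_nil, List.nil_append]
  refine List.flatMap_congr fun j hj => hlarge _ j ?_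
  have := List.mem_range'_1.mp hj
  omega

theorem lt_delta_mul {k M : ℕ} {d : Fin k → ℕ} (hk : 0 < k) (hd : ∀ m, 2 ≤ d m)
    (hM : ∑ m, d m = M + k) {t : ℕ} (ht : t < M - 2) : t < (delta d t - 1) * k := by
  have hlen := length_pDegrees d hd hM
  have h1 : (pDegrees d)[t]? = some (delta d t) := by
    rw [delta, List.getD_eq_getElem?_getD, List.getElem?_eq_getElem (by omega)]
    rfl
  have h2 : ((((standardOrder d).filter fun a => 2 ≤ a.2).map Prod.snd))[t]? =
      some (delta d t) := by
    rw [pDegrees, List.map_dropLast, List.map_dropLast, List.getElem?_dropLast] at h1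
    split_ifs at h1
    rw [List.getElem?_dropLast] at h1
    split_ifs at h1
    exact h1
  rw [map_snd_filter_standardOrder d (by omega)] at h2
  obtain ⟨h3, h4⟩ := lt_of_getElem?_flatMap_replicate
    (fun j => (List.length_filter_le _ _).trans (List.length_finRange).le) _ _ _ _ h2
  exact h4

theorem add_two_le_delta {k M : ℕ} {d : Fin k → ℕ} (hk : 0 < k) (hd : ∀ m, 2 ≤ d m)
    (hM : ∑ m, d m = M + k) {t a : ℕ} (ht : t < M - 2) (ha : a * k ≤ t) :
    a + 2 ≤ delta d t := by
  have h := ha.trans_lt (lt_delta_mul hk hd hM ht)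
  have := Nat.lt_of_mul_lt_mul_right h
  omega

end

section

/-! ### The codimension of the bad sets -/

/-- Every component of the closure of a set contains a point of the set. -/
theorem exists_mem_of_mem_minimalPrimes {σ : Type} [Finite σ] {T : Set (σ → ℂ)}
    {P : Ideal (MvPolynomial σ ℂ)} (hP : P ∈ (MvPolynomial.vanishingIdeal ℂ T).minimalPrimes) :
    ∃ t ∈ T, ∀ f ∈ P, MvPolynomial.eval t f = 0 := by
  classical
  by_contra! h
  have hfin := (MvPolynomial.vanishingIdeal ℂ T).finite_minimalPrimes_of_isNoetherianRing
    (MvPolynomial σ ℂ)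
  -- If no point of `T` lay on the component `P`, the other components would cover `T`; the
  -- intersection of their primes would then vanish on `T` and be contained in `P`.
  have hle : (hfin.toFinset.erase P).inf id ≤ P := by
    refine le_trans (fun f hf => ?_) hP.le
    refine mem_vanishingIdeal_iff_eval.mpr fun t ht => ?_
    have hker : MvPolynomial.vanishingIdeal ℂ T ≤ RingHom.ker (MvPolynomial.eval t) :=
      fun g hg => mem_vanishingIdeal_iff_eval.mp hg t ht
    have := RingHom.ker_isPrime (MvPolynomial.eval t)
    obtain ⟨Q, hQ, hQt⟩ := Ideal.exists_minimalPrimes_le hker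
    obtain ⟨g, hg, hgt⟩ := h t ht
    have hQP : Q ≠ P := by
      rintro rfl
      exact hgt (hQt hg)
    exact hQt (Finset.inf_le (f := id)
      (Finset.mem_erase.mpr ⟨hQP, hfin.mem_toFinset.mpr hQ⟩) hf)
  obtain ⟨Q, hQ, hQP⟩ := hP.isPrime.inf_le'.mp hle
  obtain ⟨hne, hmem⟩ := Finset.mem_erase.mp hQ
  have hmin := hfin.mem_toFinset.mp hmem
  exact hne (le_antisymm hQP (hP.2 hmin.1 hQP))

variable {n r : ℕ} {δ : Fin r → ℕ}

/-- The first `i + 1` polynomials of the tuple vanish on an irreducible cone of codimension at most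
`i` that spans a space of dimension `E`. -/
def VanishOnCone (i : Fin r) (E : ℕ) (p : ParamSpace n δ) : Prop :=
  ∃ C : Set (Fin n → ℂ), IsIrreducibleCone C ∧
    (MvPolynomial.vanishingIdeal ℂ C).height ≤ ((i : ℕ) : ℕ∞) ∧
    (∀ j ≤ i, ∀ y ∈ C, MvPolynomial.eval y (p j : MvPolynomial (Fin n) ℂ) = 0) ∧
    Module.finrank ℂ (Submodule.span ℂ C) = E ∧ ((i : ℕ) + 1 = r → 3 ≤ E)

theorem exists_vanishOnCone {i : Fin r} {p : ParamSpace n δ} (hp : p ∈ badSet δ i) :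
    ∃ E ≤ n, VanishOnCone i E p := by
  obtain ⟨-, B, hB, hvan, hlast⟩ := hp
  refine ⟨_, (Submodule.finrank_le _).trans (by simp), affineCone B,
    isIrreducibleCone_affineCone hB.prop.1, hB.height_le, fun j hj y hy => ?_, rfl,
    fun h => three_le_finrank_span hB.prop.1 (hlast h).2⟩
  refine eval_eq_zero_of_mem_affineCone (fun x hx => ?_) hy
  rcases hj.eq_or_lt with rfl | hj
  exacts [hvan x hx, hB.prop.2 hx j hj]

/-- A component of the closure of the bad set is a component of the closure of one of its strata. -/
theorem exists_stratum {i : Fin r} {P : Ideal (MvPolynomial (CoeffIndex n δ) ℂ)}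
    (hP : P ∈ (MvPolynomial.vanishingIdeal ℂ (coords '' badSet δ i)).minimalPrimes) :
    ∃ E ≤ n, P ∈ (MvPolynomial.vanishingIdeal ℂ
      (coords '' {p : ParamSpace n δ | p ∈ badSet δ i ∧ VanishOnCone i E p})).minimalPrimes := by
  have hle : (Finset.range (n + 1)).inf (fun E => MvPolynomial.vanishingIdeal ℂ
      (coords '' {p : ParamSpace n δ | p ∈ badSet δ i ∧ VanishOnCone i E p})) ≤ P := by
    refine le_trans (fun f hf => mem_vanishingIdeal_iff_eval.mpr ?_) hP.le
    rintro _ ⟨p, hp, rfl⟩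
    obtain ⟨E, hE, hpE⟩ := exists_vanishOnCone hp
    have hfE := Finset.inf_le (f := fun E => MvPolynomial.vanishingIdeal ℂ
      (coords '' {p : ParamSpace n δ | p ∈ badSet δ i ∧ VanishOnCone i E p}))
      (Finset.mem_range.mpr (Nat.lt_succ_of_le hE)) hf
    exact mem_vanishingIdeal_iff_eval.mp hfE _ ⟨p, ⟨hp, hpE⟩, rfl⟩
  -- There are finitely many strata, so the prime `P` contains the ideal of one of them; minimality
  -- over the smaller ideal of the whole bad set carries over.
  obtain ⟨E, hE, hEP⟩ := hP.isPrime.inf_le'.mp hle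
  refine ⟨E, Nat.lt_succ_iff.mp (Finset.mem_range.mp hE), ⟨hP.isPrime, hEP⟩, fun Q hQ hQP => ?_⟩
  exact hP.2 ⟨hQ.1, (MvPolynomial.vanishingIdeal_anti_mono
    (Set.image_mono fun p hp => hp.1)).trans hQ.2⟩ hQP

theorem le_height_of_mem_minimalPrimes {k : ℕ} (hk : 2 ≤ k) (hr : 2 * k + 1 ≤ r) (hn : n = r + 1)
    (h2 : ∀ j, 2 ≤ δ j) (h3 : ∀ j : Fin r, k ≤ j → 3 ≤ δ j)
    (h4 : ∀ j : Fin r, 2 * k ≤ j → 4 ≤ δ j) (i : Fin r)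
    {P : Ideal (MvPolynomial (CoeffIndex n δ) ℂ)}
    (hP : P ∈ (MvPolynomial.vanishingIdeal ℂ (coords '' badSet δ i)).minimalPrimes) :
    ((2 * r + 4 : ℕ) : ℕ∞) ≤ P.height := by
  have hprime := hP.isPrime
  obtain ⟨E, hEn, hPE⟩ := exists_stratum hP
  set S := {p : ParamSpace n δ | p ∈ badSet δ i ∧ VanishOnCone i E p} with hS
  -- The multipliers and linear forms are built at this one point of the component. Their
  -- determinant is nonzero at `p₀`, hence not in `P`, so discarding the tuples where it vanishes
  -- leaves a set whose vanishing ideal is still contained in `P`.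
  obtain ⟨_, ⟨p₀, hp₀, rfl⟩, hp₀P⟩ := exists_mem_of_mem_minimalPrimes hPE
  obtain ⟨m, hm⟩ : ∃ m, n = i + m := ⟨n - i, by have := i.2; omega⟩
  obtain ⟨c, lam, hlam, hdet₀⟩ := exists_multipliers p₀ hm hp₀.1.1
  have hindep : ∀ p ∈ S, MvPolynomial.eval (coords p) (c.matrix lam).det ≠ 0 →
      ∃ C : Set (Fin n → ℂ), IsIrreducibleCone C ∧
        (∀ j ≤ i, ∀ y ∈ C, MvPolynomial.eval y (p j : MvPolynomial (Fin n) ℂ) = 0) ∧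
        Module.finrank ℂ (Submodule.span ℂ C) = E ∧
        ∀ f : MvPolynomial (Fin m) ℂ, f ≠ 0 →
          ∃ y ∈ C, MvPolynomial.eval (fun u => MvPolynomial.eval y (lam u)) f ≠ 0 := by
    rintro p ⟨-, C, hC, hh, hvan, hE, -⟩ hp
    exact ⟨C, hC, hvan, hE, fun f hf => c.exists_eval_ne_zero lam hlam hC hh hm.ge p
      (fun j hj => hvan j hj.le) hp f hf⟩
  have hmE : m ≤ E := by
    obtain ⟨C, -, -, hE, hC⟩ := hindep p₀ hp₀ hdet₀
    exact hE ▸ le_finrank_span_of_independent hlam hC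
  have hlast : (i : ℕ) + 1 = r → 3 ≤ E := by
    obtain ⟨-, C, -, -, -, -, h⟩ := hp₀
    exact h
  obtain ⟨q, x, hcount, hqx⟩ := exists_numbers_of_points hk hr hn h2 h3 h4 i hm hEn hmE hlast
  have hbound := add_card_le_height (β := Fin E) (μ := Fin q) (ξ := Fin x) c hlam hm P
    {p | p ∈ S ∧ MvPolynomial.eval (coords p) (c.matrix lam).det ≠ 0}
    (by
      intro f hf
      have hmul : f * (c.matrix lam).det ∈ P := by
        refine hPE.le (mem_vanishingIdeal_iff_eval.mpr ?_)
        rintro _ ⟨p, hp, rfl⟩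
        rw [map_mul, mul_eq_zero, or_iff_not_imp_right]
        exact fun h => mem_vanishingIdeal_iff_eval.mp hf _ ⟨p, ⟨hp, h⟩, rfl⟩
      exact (hprime.mem_or_mem hmul).resolve_right fun h => hdet₀ (hp₀P _ h))
    (fun p hp => hp.2)
    (by
      rintro p ⟨hp, hdet⟩ f hf
      obtain ⟨C, hC, hvan, hE, hCf⟩ := hindep p hp hdet
      obtain ⟨hJ, ha⟩ := hqx C lam hC hlam hCf hE
      exact exists_isGeneralZero hC (by simp [hE]) hCf hJ ha hvan hf)
  simp only [Fintype.card_fin] at hbound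
  induction hht : P.height using ENat.recTopCoe with
  | top => exact le_top
  | coe a =>
    rw [hht] at hbound
    have h5 : q * n + (E + q + x) ≤ a + E * q := by exact_mod_cast hbound
    have h6 : 2 * r + 4 ≤ a := by omega
    exact_mod_cast h6

end

end FanoCI

end


theorem proposition3p2 (k M : ℕ) (d : Fin k → ℕ) (hk : 2 ≤ k) (hd : ∀ m, 2 ≤ d m)
    (hmono : Monotone d) (hM : ∑ m, d m = M + k) (hkM : 2 * k + 3 ≤ M) (i : Fin (M - 2)) :
    ((2 * M : ℕ) : ℕ∞) ≤
      FanoCI.paramCodim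
        (FanoCI.badSet (n := M - 1) (fun j : Fin (M - 2) => FanoCI.delta d j) i) := by
  rw [FanoCI.paramCodim, Ideal.height_eq_inf_minimalPrimes]
  refine le_iInf₂ fun P hP => ?_
  -- Here `r = M - 2` and `n = M - 1`, and `M ≥ 2 k + 3` is exactly `r ≥ 2 k + 1`. The values `a =
  -- 0, 1, 2` give the degree bounds 2, 3 and 4.
  have h := FanoCI.le_height_of_mem_minimalPrimes hk (by omega) (by omega)
    (fun j => FanoCI.add_two_le_delta (a := 0) (by omega) hd hM j.2 (by omega))
    (fun j hj => FanoCI.add_two_le_delta (a := 1) (by omega) hd hM j.2 (by omega))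
    (fun j hj => FanoCI.add_two_le_delta (a := 2) (by omega) hd hM j.2 hj) i hP
  have hM' : 2 * M = 2 * (M - 2) + 4 := by omega
  rw [hM']
  exact h
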